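/- **Conventions.** *PCTL.* Fix atomic propositions $a$, $b$, labels $\ell_1,\ell_2,\ldots$, and infinitely many further propositions. State formulae are $\varphi ::= p \mid \neg\varphi \mid \varphi_1\wedge\varphi_2 \mid P(\Phi)\bowtie r$ with path formulae $\Phi ::= \mathtt{X}\varphi \mid \varphi_1\,\mathtt{U}\,\varphi_2 \mid \varphi_1\,\mathtt{U}^k\varphi_2$, where $p$ is an atomic proposition, ${\bowtie}\in\{\ge,>,\le,<,=\}$, $r\in[0,1]$ is rational and $k\in\mathbb{N}$. They are interpreted in the standard way over Markov chains $M=(S,P,v)$, where $S$ is finite or countably infinite, $P$ is the transition function ($P(s,t)\in[0,1]$, $\sum_t P(s,t)=1$) and $v$ assigns to each state the set of propositions valid in it; $s\models P(\Phi)\bowtie r$ means that the probability of the set of all runs initiated in $s$ that satisfy $\Phi$ is $\bowtie r$. $\mathtt{G}_{=1}\varphi$ abbreviates $P(\mathit{true}\,\mathtt{U}\,\neg\varphi)=0$. A state $t'$ is an immediate successor of $t$ if $P(t,t')>0$; a run is an infinite sequence of states in which each state is followed by one of its immediate successors. *Machines.* A non-deterministic one-counter Minsky machine $\mathcal{M}$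 is a program $1{:}\mathit{Ins}_1;\ \cdots\ m{:}\mathit{Ins}_m$ with $m\ge 1$, where each instruction is either "$\mathit{inc}\ c;\ \mathit{goto}\ L$" or "$\mathit{if}\ c{=}0\ \mathit{then\ goto}\ L\ \mathit{else\ dec}\ c;\ \mathit{goto}\ L'$", and $L,L'\subseteq\{1,\ldots,m\}$ have one or two elements. A configuration is a pair $(i,n)$ with $1\le i\le m$ and $n\in\mathbb{N}$. Its successors $(i,n)\mapsto(i',n')$ are obtained by performing $\mathit{Ins}_i$ on the counter value $n$, with $i'$ any element of the relevant target set. A computation is an infinite sequence $C_0\mapsto C_1\mapsto\cdots$ with $C_0=(1,0)$; it is periodic if its suffixes from some two different positions are the same. *Encoding.* Let $q$ be rational with $\frac34<q<1$ and $\sqrt{4q-3}$ rational, and let $\vec\kappa=(\vec\kappa_1,\vec\kappa_2)\in(0,1)^2$ have rational components such that $\frac{1-\sqrt{4q-3}}2<\vec\kappa_1<\frac{1+\sqrt{4q-3}}2$ and $\vec\kappa_1+\vec\kappa_2<q-\frac12$. Put $$\sigma(x,y)=\Big(\frac{1-q}{1-x},\ \frac{y(1-q)}{1-x}\Big).$$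 The characteristic vector $\vec v[t]$ of a state $t$ has as its first (second) component the sum of $P(t,u)$ over all immediate successors $u$ of $t$ satisfying $a$ (respectively $b$). *Simulation.* A state $t$ represents a configuration $(i,n)$ of $\mathcal{M}$ if $t\models\ell_i$, $t\not\models\ell_j$ for all $j\in\{1,\ldots,m\}\smallsetminus\{i\}$, and $\vec v[t]=\sigma^n(\vec\kappa)$. A state $s$ simulates $\mathcal{M}$ if $s$ represents $(1,0)$ and, for every state $t$ reachable from $s$ and every configuration $C$ represented by $t$: at least one immediate successor of $t$ represents a successor of $C$, and every immediate successor $t'$ of $t$ that does not represent a successor of $C$ satisfies $\mathtt{G}_{=1}\bigwedge_{i=1}^m\neg\ell_i$. A state $s$ covers a computation $C_0,C_1,\ldots$ if $s$ simulates $\mathcal{M}$ and there is a run $s_0,s_1,\ldots$ with $s_0=s$ such that $s_i$ represents $C_i$ for every $i$. **Theorem.** For all $q$ and $\vec\kappa$ as above there is a computable function that assigns to every non-deterministic one-counter Minsky machine $\mathcal{M}$ a PCTL formula $\psi$ satisfying the following conditions: (A) For every Markov chain $M$ and every state $s$ of $M$, if $s\models\psi$, then $s$ simulates $\mathcal{M}$.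 (B) For every computation $\omega$ of $\mathcal{M}$ there exist a Markov chain $M$ and a state $s$ of $M$ such that $s\models\psi$ and $s$ covers $\omega$; furthermore, if $\omega$ is periodic, then $M$ has finitely many states. -/

import Mathlib

open MeasureTheory ProbabilityTheory

noncomputable section

namespace PCTL

/-! ### Syntax of PCTL -/

/-- The atomic propositions: the propositions `a` and `b` that define characteristic vectors, the
labels `ℓ₁, ℓ₂, …`, and an infinite supply of further propositions. -/
inductive AP : Type
  | a : AP
  | b : AP
  | label (i : ℕ) : AP
  | other (i : ℕ) : AP

/-- The comparisons `≥`, `>`, `≤`, `<`, `=`. -/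
inductive Cmp : Type
  | ge | gt | le | lt | eq

/-- `c.Holds x y` is `x ⋈ y`. -/
def Cmp.Holds : Cmp → ℝ → ℝ → Prop
  | .ge, x, y => x ≥ y
  | .gt, x, y => x > y
  | .le, x, y => x ≤ y
  | .lt, x, y => x < y
  | .eq, x, y => x = y

/-- PCTL state formulae. The three kinds of path formulae (`X φ`, `φ₁ U φ₂`, `φ₁ U^k φ₂`) occur only
directly below the operator `P(⬝) ⋈ r`, so there is one constructor for each of
`P(X φ) ⋈ r`, `P(φ₁ U φ₂) ⋈ r`, and `P(φ₁ U^k φ₂) ⋈ r`. Here `r` is a rational constant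
in `[0,1]`. -/
inductive Formula : Type
  | atom (p : AP) : Formula
  | neg (φ : Formula) : Formula
  | conj (φ₁ φ₂ : Formula) : Formula
  | probNext (c : Cmp) (r : Set.Icc (0 : ℚ) 1) (φ : Formula) : Formula
  | probUntl (c : Cmp) (r : Set.Icc (0 : ℚ) 1) (φ₁ φ₂ : Formula) : Formula
  | probUntlLE (c : Cmp) (r : Set.Icc (0 : ℚ) 1) (k : ℕ) (φ₁ φ₂ : Formula) : Formula

namespace Formula

/-- The formula `true`. -/
def tt : Formula := neg (conj (atom AP.a) (neg (atom AP.a)))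

/-- The conjunction of a finite list of formulae. -/
def bigConj : List Formula → Formula
  | [] => tt
  | φ :: l => conj φ (bigConj l)

/-- `G_{=1} φ`, which abbreviates `F_{=0} ¬φ`, i.e. `P(true U ¬φ) = 0`. -/
def alwaysAS (φ : Formula) : Formula := probUntl Cmp.eq 0 tt (neg φ)

end Formula

/-! ### An effective coding of formulae by natural numbers -/

/-- The code of an atomic proposition. -/
def AP.code : AP → ℕ
  | .a => 0
  | .b => 1
  | .label i => 2 * i + 2
  | .other i => 2 * i + 3

/-- The code of a comparison. -/
def Cmp.code : Cmp → ℕ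
  | .ge => 0
  | .gt => 1
  | .le => 2
  | .lt => 3
  | .eq => 4

/-- The code of a rational constant in `[0,1]`: the pair of its numerator and denominator. -/
def ratCode (r : Set.Icc (0 : ℚ) 1) : ℕ := Nat.pair r.1.num.natAbs r.1.den

/-- The code (Gödel number) of a formula. -/
def Formula.code : Formula → ℕ
  | .atom p => Nat.pair 0 p.code
  | .neg φ => Nat.pair 1 φ.code
  | .conj φ₁ φ₂ => Nat.pair 2 (Nat.pair φ₁.code φ₂.code)
  | .probNext c r φ => Nat.pair 3 (Nat.pair c.code (Nat.pair (ratCode r) φ.code))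
  | .probUntl c r φ₁ φ₂ =>
      Nat.pair 4 (Nat.pair c.code (Nat.pair (ratCode r) (Nat.pair φ₁.code φ₂.code)))
  | .probUntlLE c r k φ₁ φ₂ =>
      Nat.pair 5 (Nat.pair c.code (Nat.pair (ratCode r)
        (Nat.pair k (Nat.pair φ₁.code φ₂.code))))

theorem AP.code_injective : Function.Injective AP.code := by
  intro p p' h
  cases p <;> cases p' <;> simp only [AP.code] at h <;> first | rfl | omega | (congr 1; omega)

theorem Cmp.code_injective : Function.Injective Cmp.code := by
  intro c c' h
  cases c <;> cases c' <;> simp_all [Cmp.code]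

theorem ratCode_injective : Function.Injective ratCode := by
  rintro ⟨r, hr⟩ ⟨r', hr'⟩ h
  have h0 : 0 ≤ r.num := Rat.num_nonneg.mpr hr.1
  have h0' : 0 ≤ r'.num := Rat.num_nonneg.mpr hr'.1
  simp only [ratCode, Nat.pair_eq_pair] at h
  obtain ⟨h1, h2⟩ := h
  exact Subtype.ext (Rat.ext (by simp only at h1 ⊢; omega) h2)

/-- Distinct formulae have distinct codes. -/
theorem Formula.code_injective : Function.Injective Formula.code := by
  intro φ
  induction φ with
  | atom p =>
    intro ψ h
    cases ψ <;> simp only [Formula.code, Nat.pair_eq_pair] at h <;> try omega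
    rw [AP.code_injective h.2]
  | neg φ ih =>
    intro ψ h
    cases ψ <;> simp only [Formula.code, Nat.pair_eq_pair] at h <;> try omega
    rw [ih h.2]
  | conj φ₁ φ₂ ih₁ ih₂ =>
    intro ψ h
    cases ψ <;> simp only [Formula.code, Nat.pair_eq_pair] at h <;> try omega
    rw [ih₁ h.2.1, ih₂ h.2.2]
  | probNext c r φ ih =>
    intro ψ h
    cases ψ <;> simp only [Formula.code, Nat.pair_eq_pair] at h <;> try omega
    rw [Cmp.code_injective h.2.1, ratCode_injective h.2.2.1, ih h.2.2.2]
  | probUntl c r φ₁ φ₂ ih₁ ih₂ =>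
    intro ψ h
    cases ψ <;> simp only [Formula.code, Nat.pair_eq_pair] at h <;> try omega
    rw [Cmp.code_injective h.2.1, ratCode_injective h.2.2.1, ih₁ h.2.2.2.1, ih₂ h.2.2.2.2]
  | probUntlLE c r k φ₁ φ₂ ih₁ ih₂ =>
    intro ψ h
    cases ψ <;> simp only [Formula.code, Nat.pair_eq_pair] at h <;> try omega
    rw [Cmp.code_injective h.2.1, ratCode_injective h.2.2.1, h.2.2.2.1, ih₁ h.2.2.2.2.1,
      ih₂ h.2.2.2.2.2]

/-! ### Markov chains and the semantics of PCTL -/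

/-- A Markov chain with a finite or countably infinite set `S` of states. The transition
probabilities from `s` form the probability mass function `step s`. -/
structure MarkovChain where
  S : Type
  countable : Countable S
  step : S → PMF S
  val : S → Set AP

namespace MarkovChain

variable (M : MarkovChain)

instance : Countable M.S := M.countable

instance : MeasurableSpace M.S := ⊤

instance : DiscreteMeasurableSpace M.S := ⟨fun _ => trivial⟩

/-- `t` is an immediate successor of `s`. -/
def Succ (s t : M.S) : Prop := 0 < M.step s t

/-- `t` is reachable from `s`. -/
def Reachable (s t : M.S) : Prop := Relation.ReflTransGen M.Succ s t

/-- `Run(s)`: the runs initiated in `s`. -/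
def Run (s : M.S) : Set (ℕ → M.S) := {π | π 0 = s ∧ ∀ i, M.Succ (π i) (π (i + 1))}

/-- The transition probabilities as a Markov kernel. -/
def stepKernel : Kernel M.S M.S where
  toFun s := (M.step s).toMeasure
  measurable' := Measurable.of_discrete

instance : IsMarkovKernel M.stepKernel :=
  ⟨fun s => PMF.toMeasure.isProbabilityMeasure (M.step s)⟩

/-- The transition kernel as a function of the history `s₀, …, sₙ`: it only uses `sₙ`. -/
def historyKernel (n : ℕ) : Kernel (Finset.Iic n → M.S) M.S :=
  M.stepKernel.comap (fun x => x ⟨n, Finset.mem_Iic.mpr le_rfl⟩) (measurable_pi_apply _)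

instance (n : ℕ) : IsMarkovKernel (M.historyKernel n) := by
  unfold historyKernel; infer_instance

/-- The probability measure `ℙ_s` on the infinite sequences of states initiated in `s`, for which
the probability of the cylinder of `s = s₀, …, sₙ` is `∏_{i < n} P(sᵢ, sᵢ₊₁)`. -/
def pathMeasure (s : M.S) : Measure (ℕ → M.S) :=
  Kernel.traj (X := fun _ => M.S) M.historyKernel 0 (fun _ => s)

/-- `ℙ_s({π ∈ Run(s) | π ∈ E})`. -/
def prob (s : M.S) (E : Set (ℕ → M.S)) : ℝ := (M.pathMeasure s (M.Run s ∩ E)).toReal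

/-- The set of states that satisfy a PCTL formula. -/
def sat : Formula → Set M.S
  | .atom p => {s | p ∈ M.val s}
  | .neg φ => {s | s ∉ sat φ}
  | .conj φ₁ φ₂ => {s | s ∈ sat φ₁ ∧ s ∈ sat φ₂}
  | .probNext c r φ => {s | c.Holds (M.prob s {π | π 1 ∈ sat φ}) (r : ℚ)}
  | .probUntl c r φ₁ φ₂ =>
      {s | c.Holds (M.prob s {π | ∃ j, π j ∈ sat φ₂ ∧ ∀ i < j, π i ∈ sat φ₁}) (r : ℚ)}
  | .probUntlLE c r k φ₁ φ₂ =>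
      {s | c.Holds (M.prob s {π | ∃ j ≤ k, π j ∈ sat φ₂ ∧ ∀ i < j, π i ∈ sat φ₁}) (r : ℚ)}

/-- `s ⊨ φ`. -/
def Sat (s : M.S) (φ : Formula) : Prop := s ∈ M.sat φ

/-- The probability of entering an immediate successor of `t` that satisfies `p`. -/
def succProb (t : M.S) (p : AP) : ℝ :=
  (∑' u : {u : M.S | M.Succ t u ∧ p ∈ M.val u}, M.step t u).toReal

/-- The characteristic vector of `t`. -/
def charVec (t : M.S) : ℝ × ℝ := (M.succProb t AP.a, M.succProb t AP.b)

end MarkovChain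

end PCTL

/-! ### Non-deterministic one-counter Minsky machines -/

namespace Minsky

/-- A set of labels with one or two elements: `(u, v)` stands for `{u, v}`, where `u = v` is
allowed. -/
abbrev Target : Type := ℕ × ℕ

/-- The labels in the target set. -/
def Target.labels (L : Target) : Set ℕ := {L.1, L.2}

/-- Instructions operating on the counter `c`:
`inc L` is `inc c; goto L`, and `testDec L L'` is `if c = 0 then goto L else dec c; goto L'`. -/
inductive Instr : Type
  | inc (L : Target) : Instr
  | testDec (L L' : Target) : Instr

/-- Instructions as elements of a disjoint union. -/
def Instr.equivSum : Instr ≃ Target ⊕ (Target × Target) where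
  toFun
    | .inc L => .inl L
    | .testDec L L' => .inr (L, L')
  invFun
    | .inl L => .inc L
    | .inr p => .testDec p.1 p.2
  left_inv i := by cases i <;> rfl
  right_inv x := by rcases x with _ | ⟨_, _⟩ <;> rfl

instance : Primcodable Instr := Primcodable.ofEquiv _ Instr.equivSum

/-- A program `1 : Ins₁; …; m : Insₘ` is given by the list `[Ins₁, …, Insₘ]`. -/
abbrev Program : Type := List Instr

/-- The labels `1, …, m` of the instructions of the program. -/
def Program.labels (P : Program) : Set ℕ := {i | 1 ≤ i ∧ i ≤ P.length}

/-- All labels that an instruction mentions belong to `s`. -/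
def Instr.LabelsIn (s : Set ℕ) : Instr → Prop
  | .inc L => L.labels ⊆ s
  | .testDec L L' => L.labels ⊆ s ∧ L'.labels ⊆ s

/-- The program is a non-deterministic one-counter Minsky machine: there is at least one
instruction, and all target labels are labels of the program. -/
def Program.IsMachine (P : Program) : Prop :=
  1 ≤ P.length ∧ ∀ ins ∈ P, ins.LabelsIn (Program.labels P)

/-- A pair `(i, n)` of a control position and a counter value. -/
abbrev Config : Type := ℕ × ℕ

/-- `(i', n')` is obtained by performing the given instruction with counter value `n`. -/
def Instr.Performs : Instr → ℕ → Config → Prop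
  | .inc L, n, (i', n') => i' ∈ L.labels ∧ n' = n + 1
  | .testDec L L', n, (i', n') =>
      (n = 0 ∧ i' ∈ L.labels ∧ n' = 0) ∨ (n ≠ 0 ∧ i' ∈ L'.labels ∧ n = n' + 1)

/-- `C'` is a successor configuration of `C`, written `C ↦ C'`. The instruction with label `i ≥ 1`
is the list entry with index `i - 1`. -/
def Program.Step (P : Program) (C C' : Config) : Prop :=
  ∃ ins, 1 ≤ C.1 ∧ P[C.1 - 1]? = some ins ∧ ins.Performs C.2 C'

/-- `ω` is a computation of the machine. -/
def Program.IsComputation (P : Program) (ω : ℕ → Config) : Prop :=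
  ω 0 = (1, 0) ∧ ∀ i, Program.Step P (ω i) (ω (i + 1))

/-- `ω` is periodic: two of its suffixes that start at different positions are the same. -/
def Periodic (ω : ℕ → Config) : Prop :=
  ∃ i j, i < j ∧ ∀ k, ω (i + k) = ω (j + k)

end Minsky

/-! ### Simulating a machine by a state of a Markov chain -/

namespace PCTL

open Minsky

/-- The interval `I_q`. -/
def Iq (q : ℝ) : Set ℝ := Set.Ioo ((1 - √(4 * q - 3)) / 2) ((1 + √(4 * q - 3)) / 2)

/-- The function `σ`, which represents the increment of the counter. -/
def sigma (q : ℝ) (v : ℝ × ℝ) : ℝ × ℝ :=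
  ((1 - q) / (1 - v.1), (v.2 * (1 - q)) / (1 - v.1))

/-- The formula `¬ℓ₁ ∧ … ∧ ¬ℓₘ`. -/
def noLabel (P : Program) : Formula :=
  Formula.bigConj ((List.range P.length).map fun i => .neg (.atom (.label (i + 1))))

namespace MarkovChain

variable (M : MarkovChain) (q : ℝ) (κ : ℝ × ℝ) (P : Program)

/-- The state `t` represents the configuration `C = (i, n)`. -/
def Represents (t : M.S) (C : Config) : Prop :=
  C.1 ∈ Program.labels P ∧
  M.Sat t (.atom (.label C.1)) ∧
  (∀ j ∈ Program.labels P, j ≠ C.1 → ¬ M.Sat t (.atom (.label j))) ∧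
  M.charVec t = (sigma q)^[C.2] κ

/-- The state `t` represents a successor configuration of `C`. -/
def RepresentsSuccOf (t : M.S) (C : Config) : Prop :=
  ∃ C', Program.Step P C C' ∧ M.Represents q κ P t C'

/-- The state `s` simulates the machine. -/
def Simulates (s : M.S) : Prop :=
  M.Represents q κ P s (1, 0) ∧
  ∀ t, M.Reachable s t → ∀ C, M.Represents q κ P t C →
    (∃ t', M.Succ t t' ∧ M.RepresentsSuccOf q κ P t' C) ∧
    ∀ t', M.Succ t t' → ¬ M.RepresentsSuccOf q κ P t' C → M.Sat t' (noLabel P).alwaysAS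

/-- The state `s` covers `ω`: it simulates the machine, and some run initiated in `s` consists of
states representing the consecutive configurations of `ω`. -/
def Covers (s : M.S) (ω : ℕ → Config) : Prop :=
  M.Simulates q κ P s ∧ ∃ π ∈ M.Run s, ∀ i, M.Represents q κ P (π i) (ω i)

end MarkovChain

end PCTL

end

/-!
The formula `machineF q κ P` speaks about *counter states*: labelled states, which represent
configurations, and unlabelled verification states, which only carry a counter value. A counter
state moves to leaves satisfying `a` and `b` with the probabilities `x` and `y` that form its
characteristic vector, to leaves `cF` and `dF` with the complementary probabilities `κ₁ - x` and
`κ₂ - y`, and to further counter states. Since the leaves enter a goal state with prescribed rational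
probabilities, formulae `P(φ₁ U^2 φ₂) = r` express linear equations between `x`, `y`, the weight of
a set of successors, and the weighted sums of the characteristic vectors of these successors. A
parity bit separates the leaves of a state from the leaves of its successors.

The map `sigma q` is projective, so the relation "the vectors of the successors average to the image
(or preimage) of the vector of this state" is of that linear form (`sat_incF`, `sat_decF`). What has
to be excluded is that the average is right although the individual successors are wrong. For this,
every counter state whose vector is not `κ` is required to have counter successors, labelled or not,
that average to the preimage of its vector. The orbit of `κ` under `sigma q` is in convex
position, and `edge q κ n` is the linear form that vanishes on the line through the points with the
numbers `n` and `n + 1`. The formula demands that `edge q κ 0` is nonnegative in all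
counter states. As `edge q κ (n + 1)` at a state is a weighted sum of values of `edge q κ n` at
successors, induction on `n` shows that all edge forms are nonnegative in all counter states
(`edge_charVec_nonneg`); the case of the vector `κ` itself follows from a linear recurrence
(`edge_self_nonneg`). No termination argument is needed. Hence each point of the orbit is an extreme
point of a convex region that contains all characteristic vectors, and an average of such
vectors equals that point only if all of them do (`charVec_eq_of_average`). So labelled successors
represent the correct counter value, and every model simulates the machine
(`simulates_of_sat_machineF`).

Conversely, the model of a computation has one labelled state for each pair of a suffix of the
computation and a parity, and one verification state for each occurring counter value and
parity (`Unfolding.chain`). A periodic computation has finitely many suffixes, so that its model is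
finite (`exists_model`).
-/

noncomputable section

namespace PCTL.MarkovChain

variable (M : MarkovChain)

/-! ### Averages over the successors, and the path measure -/

/-- The expected value of `f` in the next state, when the chain is in the state `t`. -/
def ave (t : M.S) (f : M.S → ℝ) : ℝ := ∫ u, f u ∂(M.step t).toMeasure

/-- The probability of moving from `t` to a state in `A`. -/
def stepProb (t : M.S) (A : Set M.S) : ℝ := (M.step t).toMeasure.real A

variable {M}

theorem ae_step_iff {t : M.S} {p : M.S → Prop} :
    (∀ᵐ u ∂(M.step t).toMeasure, p u) ↔ ∀ u, M.Succ t u → p u := by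
  rw [ae_iff, PMF.toMeasure_apply_eq_zero_iff _ (MeasurableSet.of_discrete),
    Set.disjoint_left]
  refine forall_congr' fun u => ?_
  rw [PMF.mem_support_iff, ← pos_iff_ne_zero]
  simp [Succ]

theorem integrable_step {t : M.S} {f : M.S → ℝ} {C : ℝ} (h : ∀ u, |f u| ≤ C) :
    Integrable f (M.step t).toMeasure :=
  Integrable.of_bound (Measurable.of_discrete.aestronglyMeasurable) C (ae_of_all _ h)

theorem stepProb_eq_ave (t : M.S) (A : Set M.S) :
    M.stepProb t A = M.ave t (A.indicator 1) := by
  rw [stepProb, ave, integral_indicator_one MeasurableSet.of_discrete]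

theorem stepProb_nonneg (t : M.S) (A : Set M.S) : 0 ≤ M.stepProb t A := measureReal_nonneg

theorem stepProb_le_one (t : M.S) (A : Set M.S) : M.stepProb t A ≤ 1 := measureReal_le_one

theorem stepProb_eq_zero_iff {t : M.S} {A : Set M.S} :
    M.stepProb t A = 0 ↔ ∀ u, M.Succ t u → u ∉ A := by
  rw [← ae_step_iff, stepProb, measureReal_eq_zero_iff, ae_iff]
  simp

theorem stepProb_eq_one_iff {t : M.S} {A : Set M.S} :
    M.stepProb t A = 1 ↔ ∀ u, M.Succ t u → u ∈ A := by
  have := probReal_compl_eq_one_sub (μ := (M.step t).toMeasure) (s := A) .of_discrete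
  have h2 := stepProb_eq_zero_iff (M := M) (t := t) (A := Aᶜ)
  simp only [Set.mem_compl_iff, not_not] at h2
  rw [← h2, stepProb, stepProb, this]
  constructor <;> intro h <;> linarith

theorem ave_congr {t : M.S} {f g : M.S → ℝ} (h : ∀ u, M.Succ t u → f u = g u) :
    M.ave t f = M.ave t g :=
  integral_congr_ae (ae_step_iff.2 h)

theorem stepProb_congr {t : M.S} {A B : Set M.S} (h : ∀ u, M.Succ t u → (u ∈ A ↔ u ∈ B)) :
    M.stepProb t A = M.stepProb t B := by
  classical
  rw [stepProb_eq_ave, stepProb_eq_ave]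
  exact ave_congr fun u hu => by simp [Set.indicator_apply, h u hu]

theorem stepProb_union {t : M.S} {A B : Set M.S}
    (h : ∀ u, M.Succ t u → u ∈ A → u ∉ B) :
    M.stepProb t (A ∪ B) = M.stepProb t A + M.stepProb t B := by
  have : M.stepProb t B = M.stepProb t (B \ A) :=
    stepProb_congr fun u hu => ⟨fun hb => ⟨hb, fun ha => h u hu ha hb⟩, fun hb => hb.1⟩
  rw [this, stepProb, stepProb, stepProb, ← Set.union_sdiff_self,
    measureReal_union Set.disjoint_sdiff_right .of_discrete]

/-- The function `succProb` of the definition of characteristic vectors is a probability of the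
next state. -/
theorem succProb_eq_stepProb (t : M.S) (p : AP) :
    M.succProb t p = M.stepProb t {u | p ∈ M.val u} := by
  rw [succProb, stepProb, Measure.real, PMF.toMeasure_apply_eq_tsum,
    tsum_subtype {u | M.Succ t u ∧ p ∈ M.val u} (fun u => M.step t u)]
  congr 2
  funext u
  by_cases hu : M.Succ t u
  · by_cases hp : p ∈ M.val u <;> simp [hu, hp]
  · have h0 : M.step t u = 0 := by simpa [Succ] using hu
    by_cases hp : p ∈ M.val u <;> simp [h0, hp, hu]

instance (s : M.S) : IsProbabilityMeasure (M.pathMeasure s) := by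
  unfold pathMeasure; infer_instance

theorem pathMeasure_ae_zero (s : M.S) : ∀ᵐ π ∂M.pathMeasure s, π 0 = s := by
  have h := Kernel.traj_map_frestrictLe_apply (X := fun _ => M.S) (κ := M.historyKernel) 0 0
    (fun _ => s)
  rw [Kernel.partialTraj_self, Kernel.id_apply] at h
  have h2 : ∀ᵐ y ∂(M.pathMeasure s).map (Preorder.frestrictLe (π := fun _ => M.S) 0),
      y ⟨0, by simp⟩ = s := by
    rw [pathMeasure, h]
    rw [ae_dirac_iff]
    exact (measurable_pi_apply (X := fun _ => M.S) _) (MeasurableSet.of_discrete (s := {s}))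
  exact ae_of_ae_map (by fun_prop) h2

/-- The Markov property: conditionally on the state at time `n`, the state at time `n + 1` is
distributed according to the transition probabilities. -/
theorem lintegral_pathMeasure_succ (s : M.S) (n : ℕ) (g : M.S → M.S → ENNReal) :
    ∫⁻ π, g (π n) (π (n + 1)) ∂M.pathMeasure s =
      ∫⁻ π, ∫⁻ u, g (π n) u ∂(M.step (π n)).toMeasure ∂M.pathMeasure s := by
  have h := Kernel.partialTraj_compProd_eq_map_traj (X := fun _ => M.S) (κ := M.historyKernel)
    (Nat.zero_le n) (x₀ := fun _ => s)
  have hg : Measurable fun p : M.S × M.S => g p.1 p.2 := Measurable.of_discrete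
  have hm : Measurable fun p : (Finset.Iic n → M.S) × M.S => g (p.1 ⟨n, by simp⟩) p.2 :=
    hg.comp (g := fun p : M.S × M.S => g p.1 p.2)
      (f := fun p : (Finset.Iic n → M.S) × M.S => (p.1 ⟨n, by simp⟩, p.2)) (by fun_prop)
  have e1 : ∫⁻ π, g (π n) (π (n + 1)) ∂M.pathMeasure s =
      ∫⁻ p, g (p.1 ⟨n, by simp⟩) p.2 ∂((M.pathMeasure s).map
        (fun x => (Preorder.frestrictLe (π := fun _ => M.S) n x, x (n + 1)))) := by
    rw [lintegral_map hm (by fun_prop)]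
    rfl
  rw [e1]
  unfold pathMeasure
  erw [← h]
  rw [Measure.lintegral_compProd hm]
  rw [← Kernel.traj_map_frestrictLe_apply, lintegral_map _ (by fun_prop)]
  · rfl
  · exact Measurable.lintegral_kernel_prod_right' (κ := M.historyKernel n) hm

theorem pathMeasure_ae_run (s : M.S) : ∀ᵐ π ∂M.pathMeasure s, π ∈ M.Run s := by
  classical
  have h : ∀ n, ∀ᵐ π ∂M.pathMeasure s, M.Succ (π n) (π (n + 1)) := by
    intro n
    have h1 := lintegral_pathMeasure_succ s n
      (fun u v => if M.Succ u v then 0 else 1)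
    have h2 : ∀ t : M.S, ∫⁻ u, (if M.Succ t u then 0 else 1 : ENNReal) ∂(M.step t).toMeasure = 0 := by
      intro t
      rw [lintegral_eq_zero_iff Measurable.of_discrete]
      refine ae_step_iff.2 fun u hu => ?_
      simp [hu]
    simp only [h2, lintegral_zero] at h1
    have hm : Measurable fun π : ℕ → M.S =>
        (if M.Succ (π n) (π (n + 1)) then 0 else 1 : ENNReal) :=
      (Measurable.of_discrete (f := fun p : M.S × M.S =>
        (if M.Succ p.1 p.2 then 0 else 1 : ENNReal))).comp
        (f := fun π : ℕ → M.S => (π n, π (n + 1))) (by fun_prop)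
    rw [lintegral_eq_zero_iff hm] at h1
    filter_upwards [h1] with π hπ
    by_contra hc
    simp [hc] at hπ
  filter_upwards [pathMeasure_ae_zero s, ae_all_iff.2 h] with π h0 h1
  exact ⟨h0, h1⟩

theorem prob_eq (s : M.S) (E : Set (ℕ → M.S)) : M.prob s E = (M.pathMeasure s).real E := by
  rw [prob, Measure.real]
  congr 1
  refine measure_congr ?_
  filter_upwards [pathMeasure_ae_run s] with π hπ
  exact propext ⟨fun h => h.2, fun h => ⟨hπ, h⟩⟩

theorem prob_congr {s : M.S} {E F : Set (ℕ → M.S)} (h : ∀ π ∈ M.Run s, π ∈ E ↔ π ∈ F) :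
    M.prob s E = M.prob s F := by
  rw [prob, prob]
  congr 2
  ext π
  exact ⟨fun hp => ⟨hp.1, (h π hp.1).1 hp.2⟩, fun hp => ⟨hp.1, (h π hp.1).2 hp.2⟩⟩

theorem lintegral_pathMeasure_one (s : M.S) (g : M.S → ENNReal) :
    ∫⁻ π, g (π 1) ∂M.pathMeasure s = ∫⁻ u, g u ∂(M.step s).toMeasure := by
  rw [lintegral_pathMeasure_succ s 0 (fun _ u => g u)]
  have : ∀ᵐ π ∂M.pathMeasure s, ∫⁻ u, g u ∂(M.step (π 0)).toMeasure =
      ∫⁻ u, g u ∂(M.step s).toMeasure := by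
    filter_upwards [pathMeasure_ae_zero s] with π hπ
    rw [hπ]
  rw [lintegral_congr_ae this]
  simp

theorem prob_one (s : M.S) (A : Set M.S) : M.prob s {π | π 1 ∈ A} = M.stepProb s A := by
  have h := lintegral_pathMeasure_one s (A.indicator 1)
  rw [lintegral_indicator_one .of_discrete] at h
  rw [prob_eq, stepProb, Measure.real, Measure.real, ← h]
  congr 1
  have : (fun π : ℕ → M.S => (A.indicator 1 (π 1) : ENNReal)) =
      {π : ℕ → M.S | π 1 ∈ A}.indicator 1 := by
    funext π
    by_cases hp : π 1 ∈ A <;> simp [hp]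
  rw [this, lintegral_indicator_one]
  exact measurable_pi_apply (X := fun _ => M.S) 1 (MeasurableSet.of_discrete (s := A))

/-- The probability of reaching `B` at time `1`, or through `A` at time `2`. -/
theorem prob_two (s : M.S) (A B : Set M.S) [DecidablePred (· ∈ A)] [DecidablePred (· ∈ B)] :
    M.prob s {π | π 1 ∈ B ∨ (π 1 ∈ A ∧ π 2 ∈ B)} =
      M.ave s fun u => if u ∈ B then 1 else if u ∈ A then M.stepProb u B else 0 := by
  have h := lintegral_pathMeasure_succ s 1
    (fun u v => if u ∈ B then 1 else if u ∈ A then (if v ∈ B then 1 else 0) else 0)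
  have h1 : ∀ u, ∫⁻ v, (if u ∈ B then 1 else if u ∈ A then (if v ∈ B then 1 else 0) else 0 :
      ENNReal) ∂(M.step u).toMeasure =
      ENNReal.ofReal (if u ∈ B then 1 else if u ∈ A then M.stepProb u B else 0) := by
    intro u
    split_ifs with h1 h2
    · simp
    · rw [stepProb, ofReal_measureReal, ← lintegral_indicator_one .of_discrete]
      simp [Set.indicator_apply]
    · simp
  simp only [h1] at h
  rw [lintegral_pathMeasure_one s (fun u => ENNReal.ofReal
    (if u ∈ B then 1 else if u ∈ A then M.stepProb u B else 0))] at h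
  rw [ave, integral_eq_lintegral_of_nonneg_ae _ Measurable.of_discrete.aestronglyMeasurable,
    ← h, prob_eq, Measure.real]
  · congr 1
    have : (fun π : ℕ → M.S => (if π 1 ∈ B then 1 else if π 1 ∈ A then
        (if π (1 + 1) ∈ B then 1 else 0) else 0 : ENNReal)) =
        {π : ℕ → M.S | π 1 ∈ B ∨ (π 1 ∈ A ∧ π 2 ∈ B)}.indicator 1 := by
      funext π
      by_cases h1 : π 1 ∈ B <;> by_cases h2 : π 1 ∈ A <;> by_cases h3 : π 2 ∈ B <;>
        simp [h1, h2, h3]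
    rw [this, lintegral_indicator_one]
    have hm := fun n (C : Set M.S) => measurable_pi_apply (X := fun _ : ℕ => M.S) n
      (MeasurableSet.of_discrete (s := C))
    exact (hm 1 B).union ((hm 1 A).inter (hm 2 B))
  · refine ae_of_all _ fun u => ?_
    dsimp only [Pi.zero_apply]
    split_ifs
    · exact zero_le_one
    · exact stepProb_nonneg _ _
    · exact le_rfl

/-- A reachable state is visited at some fixed time with positive probability. -/
theorem Reachable.exists_pos {s t : M.S} (h : M.Reachable s t) :
    ∃ n, 0 < M.pathMeasure s {π | π n = t} := by
  classical
  induction h with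
  | refl =>
    refine ⟨0, ?_⟩
    rw [(prob_compl_eq_zero_iff (μ := M.pathMeasure s) (s := {π | π 0 = s})
      (measurable_pi_apply (X := fun _ => M.S) 0 (MeasurableSet.of_discrete (s := {s})))).1
      (pathMeasure_ae_zero s)]
    exact zero_lt_one
  | @tail u v _ huv ih =>
    obtain ⟨n, hn⟩ := ih
    refine ⟨n + 1, ?_⟩
    have hm := fun n (C : Set M.S) => measurable_pi_apply (X := fun _ : ℕ => M.S) n
      (MeasurableSet.of_discrete (s := C))
    have h := lintegral_pathMeasure_succ s n
      (fun u' v' => if u' = u ∧ v' = v then 1 else 0)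
    have h1 : ∀ u', ∫⁻ v', (if u' = u ∧ v' = v then 1 else 0 : ENNReal) ∂(M.step u').toMeasure =
        if u' = u then M.step u v else 0 := by
      intro u'
      by_cases hu : u' = u
      · subst hu
        have := lintegral_indicator_one (μ := (M.step u').toMeasure)
          (MeasurableSet.of_discrete (s := {v}))
        rw [PMF.toMeasure_apply_singleton _ _ .of_discrete] at this
        simp only [true_and, if_true]
        rw [← this]
        simp [Set.indicator_apply]
      · simp [hu]
    simp only [h1] at h
    have h2 : (fun π : ℕ → M.S => if π n = u then M.step u v else 0) =
        {π : ℕ → M.S | π n = u}.indicator (fun _ => M.step u v) := by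
      funext π; simp [Set.indicator_apply]
    have h5 := lintegral_indicator_const (μ := M.pathMeasure s) (hm n {u}) (M.step u v)
    have h3 : 0 < M.step u v * M.pathMeasure s {π | π n = u} := ENNReal.mul_pos huv.ne' hn.ne'
    rw [h2] at h
    erw [← h5, ← h] at h3
    refine h3.trans_le ?_
    have h4 := lintegral_indicator_one (μ := M.pathMeasure s) (hm (n + 1) {v})
    change _ ≤ M.pathMeasure s ((fun b : ℕ → M.S => b (n + 1)) ⁻¹' {v})
    rw [← h4]
    refine lintegral_mono fun π => ?_
    by_cases hv : π (n + 1) = v <;> simp [hv]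
    split_ifs <;> simp

theorem Reachable.of_succ {s t u : M.S} (h : M.Reachable s t) (hu : M.Succ t u) :
    M.Reachable s u := Relation.ReflTransGen.tail h hu

theorem reachable_of_mem_run {s : M.S} {π : ℕ → M.S} (h : π ∈ M.Run s) (n : ℕ) :
    M.Reachable s (π n) := by
  induction n with
  | zero => rw [h.1]; exact Relation.ReflTransGen.refl
  | succ n ih => exact ih.of_succ (h.2 n)

end PCTL.MarkovChain

namespace PCTL

/-! ### The orbit of the characteristic vector and its edges -/

/-- The numerical assumptions on the parameters `q` and `κ`, over the reals. -/
structure Admissible (q : ℝ) (κ : ℝ × ℝ) : Prop where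
  q_gt : 3 / 4 < q
  q_lt : q < 1
  fst_pos : 0 < κ.1
  fst_lt : κ.1 < 1
  snd_pos : 0 < κ.2
  snd_lt : κ.2 < 1
  mem_Iq : κ.1 ∈ Iq q
  sum_lt : κ.1 + κ.2 < q - 1 / 2

/-- The quadratic polynomial `x - x² - (1 - q)`, which is positive exactly on the interval `Iq q`;
up to a positive factor it is the amount by which `sigma q` decreases the first coordinate `x`. -/
def disc (q x : ℝ) : ℝ := x - x ^ 2 - (1 - q)

theorem disc_pos_of_mem_Iq {q x : ℝ} (hq : 3 / 4 < q) (hx : x ∈ Iq q) : 0 < disc q x := by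
  have h1 := Real.sq_sqrt (show 0 ≤ 4 * q - 3 by linarith)
  obtain ⟨h2, h3⟩ := hx
  have h4 : 0 < (x - (1 - √(4 * q - 3)) / 2) * ((1 + √(4 * q - 3)) / 2 - x) :=
    mul_pos (by linarith) (by linarith)
  rw [disc]
  nlinarith

variable {q : ℝ} {κ : ℝ × ℝ}

namespace Admissible

theorem disc_pos (h : Admissible q κ) : 0 < disc q κ.1 := disc_pos_of_mem_Iq h.q_gt h.mem_Iq

theorem iterate_sigma_bounds (h : Admissible q κ) (n : ℕ) :
    0 < ((sigma q)^[n] κ).1 ∧ ((sigma q)^[n] κ).1 ≤ κ.1 ∧ 0 < disc q ((sigma q)^[n] κ).1 ∧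
      0 < ((sigma q)^[n] κ).2 ∧ ((sigma q)^[n] κ).2 ≤ κ.2 ∧
      ((sigma q)^[n] κ).2 * (q - ((sigma q)^[n] κ).1) * disc q κ.1 ≤
        κ.2 * (q - κ.1) * disc q ((sigma q)^[n] κ).1 := by
  have hq := h.q_lt
  induction n with
  | zero =>
    exact ⟨h.fst_pos, le_rfl, h.disc_pos, h.snd_pos, le_rfl, by simp⟩
  | succ n ih =>
    rw [Function.iterate_succ_apply']
    generalize (sigma q)^[n] κ = v at ih
    obtain ⟨x, y⟩ := v
    obtain ⟨h1, h2, h3, h4, h5, h6⟩ := ih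
    simp only at h1 h2 h3 h4 h5 h6
    have h7 : 0 < 1 - x := by linarith [h.fst_lt]
    have h8 : (1 - q) / (1 - x) < x := by
      rw [div_lt_iff₀ h7]; unfold disc at h3; linarith
    have h9 : 0 < (1 - q) / (1 - x) := div_pos (by linarith) h7
    have hd : disc q ((1 - q) / (1 - x)) = (1 - q) * disc q x / (1 - x) ^ 2 := by
      unfold disc; field_simp; ring
    have h10 : y * (1 - q) / (1 - x) = y * ((1 - q) / (1 - x)) := by ring
    have h11 : x < 1 := by linarith
    simp only [sigma]
    refine ⟨h9, by linarith, ?_, ?_, ?_, ?_⟩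
    · rw [hd]
      exact div_pos (mul_pos (by linarith) h3) (by positivity)
    · rw [h10]; positivity
    · rw [h10]
      nlinarith
    · rw [hd]
      -- the step holds because `2 q - 1 - q x ≤ q - x`
      have h12 : y * (2 * q - 1 - q * x) * disc q κ.1 ≤ κ.2 * (q - κ.1) * disc q x := by
        refine le_trans ?_ h6
        have := h.disc_pos
        have h13 : 2 * q - 1 - q * x ≤ q - x := by nlinarith
        gcongr
      have h14 : y * (1 - q) / (1 - x) * (q - (1 - q) / (1 - x)) * disc q κ.1 =
          (1 - q) / (1 - x) ^ 2 * (y * (2 * q - 1 - q * x) * disc q κ.1) := by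
        field_simp; ring
      have h15 : κ.2 * (q - κ.1) * ((1 - q) * disc q x / (1 - x) ^ 2) =
          (1 - q) / (1 - x) ^ 2 * (κ.2 * (q - κ.1) * disc q x) := by
        field_simp
      rw [h14, h15]
      have : 0 < 1 - q := by linarith
      gcongr

theorem iterate_sigma_fst_pos (h : Admissible q κ) (n : ℕ) : 0 < ((sigma q)^[n] κ).1 :=
  (h.iterate_sigma_bounds n).1

theorem iterate_sigma_fst_le (h : Admissible q κ) (n : ℕ) : ((sigma q)^[n] κ).1 ≤ κ.1 :=
  (h.iterate_sigma_bounds n).2.1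

theorem iterate_sigma_snd_pos (h : Admissible q κ) (n : ℕ) : 0 < ((sigma q)^[n] κ).2 :=
  (h.iterate_sigma_bounds n).2.2.2.1

theorem iterate_sigma_snd_le (h : Admissible q κ) (n : ℕ) : ((sigma q)^[n] κ).2 ≤ κ.2 :=
  (h.iterate_sigma_bounds n).2.2.2.2.1

theorem one_sub_iterate_sigma_pos (h : Admissible q κ) (n : ℕ) : 0 < 1 - ((sigma q)^[n] κ).1 := by
  linarith [h.iterate_sigma_fst_le n, h.fst_lt]

theorem iterate_sigma_succ_fst (h : Admissible q κ) (n : ℕ) :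
    ((sigma q)^[n + 1] κ).1 * (1 - ((sigma q)^[n] κ).1) = 1 - q := by
  rw [Function.iterate_succ_apply', sigma]
  exact div_mul_cancel₀ _ (h.one_sub_iterate_sigma_pos n).ne'

theorem iterate_sigma_succ_snd (n : ℕ) :
    ((sigma q)^[n + 1] κ).2 = ((sigma q)^[n] κ).2 * ((sigma q)^[n + 1] κ).1 := by
  rw [Function.iterate_succ_apply', sigma]
  exact mul_div_assoc _ _ _

theorem iterate_sigma_succ_fst_lt (h : Admissible q κ) (n : ℕ) :
    ((sigma q)^[n + 1] κ).1 < κ.1 := by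
  have h1 := h.iterate_sigma_succ_fst n
  have h2 := (h.iterate_sigma_bounds n).2.2.1
  have h3 := h.one_sub_iterate_sigma_pos n
  have h4 := h.iterate_sigma_fst_le n
  unfold disc at h2
  nlinarith

theorem iterate_sigma_eq_self_iff (h : Admissible q κ) {n : ℕ} : (sigma q)^[n] κ = κ ↔ n = 0 := by
  constructor
  · intro he
    cases n with
    | zero => rfl
    | succ n => exact absurd (congrArg Prod.fst he) (h.iterate_sigma_succ_fst_lt n).ne
  · rintro rfl; rfl

end Admissible

/-- `edge q κ n (w, X, Y)` is a homogeneous linear form in the projective coordinates `(w, X, Y)` of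
the point `(X / w, Y / w)`. For `n = 0`, it vanishes on the line through `κ` and `sigma q κ`. The
forms for larger `n` are obtained by composition with the linear map
`(w, X, Y) ↦ (X, X - (1 - q) w, Y)`, which induces the inverse of the projective map `sigma q`,
so that `edge q κ n` vanishes on the line through `(sigma q)^[n] κ` and `(sigma q)^[n + 1] κ`. -/
def edge (q : ℝ) (κ : ℝ × ℝ) : ℕ → ℝ → ℝ → ℝ → ℝ
  | 0, w, X, Y => κ.2 * (q - κ.1) * (κ.1 * w - X) - disc q κ.1 * (κ.2 * w - Y)
  | n + 1, w, X, Y => edge q κ n X (X - (1 - q) * w) Y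

theorem exists_edge_eq (q : ℝ) (κ : ℝ × ℝ) (n : ℕ) :
    ∃ α β γ : ℝ, ∀ w X Y, edge q κ n w X Y = α * w + β * X + γ * Y := by
  induction n with
  | zero =>
    refine ⟨κ.2 * (q - κ.1) * κ.1 - disc q κ.1 * κ.2, - (κ.2 * (q - κ.1)), disc q κ.1, ?_⟩
    intro w X Y
    rw [edge]; ring
  | succ n ih =>
    obtain ⟨α, β, γ, h⟩ := ih
    refine ⟨-(1 - q) * β, α + β, γ, fun w X Y => ?_⟩
    rw [edge, h]; ring

theorem edge_smul (n : ℕ) (c w X Y : ℝ) :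
    edge q κ n (c * w) (c * X) (c * Y) = c * edge q κ n w X Y := by
  obtain ⟨α, β, γ, h⟩ := exists_edge_eq q κ n
  rw [h, h]; ring

theorem edge_recurrence (n : ℕ) (w X Y : ℝ) :
    edge q κ (n + 3) w X Y - edge q κ (n + 2) w X Y =
      (edge q κ (n + 2) w X Y - edge q κ (n + 1) w X Y) -
        (1 - q) * (edge q κ (n + 1) w X Y - edge q κ n w X Y) := by
  induction n generalizing w X Y with
  | zero => simp only [edge]; ring
  | succ n ih => exact ih X (X - (1 - q) * w) Y

namespace Admissible

/-- The successive differences of the sequence `edge q κ n 1 κ.1 κ.2` satisfy the linear recurrence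
`d (n + 2) = d (n + 1) - (1 - q) d n`, whose characteristic roots are positive; so they stay
nonnegative. -/
theorem edge_self_nonneg (h : Admissible q κ) (n : ℕ) : 0 ≤ edge q κ n 1 κ.1 κ.2 := by
  obtain ⟨r, hr0, hr1, hr⟩ : ∃ r : ℝ, 0 ≤ r ∧ r ≤ 1 ∧ r * (1 - r) = 1 - q := by
    have h1 := Real.sq_sqrt (show 0 ≤ 4 * q - 3 by linarith [h.q_gt])
    have h2 := Real.sqrt_nonneg (4 * q - 3)
    have h3 : √(4 * q - 3) ≤ 1 := Real.sqrt_le_one.2 (by linarith [h.q_lt])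
    exact ⟨(1 - √(4 * q - 3)) / 2, by linarith, by linarith, by nlinarith⟩
  have h0 : edge q κ 0 1 κ.1 κ.2 = 0 := by simp [edge]
  have h1 : edge q κ 1 1 κ.1 κ.2 = κ.2 * (1 - q) * disc q κ.1 := by
    simp only [edge, disc]; ring
  have h2 : edge q κ 2 1 κ.1 κ.2 - edge q κ 1 1 κ.1 κ.2 = κ.2 * (1 - q) * disc q κ.1 := by
    simp only [edge, disc]; ring
  have hpos : 0 ≤ κ.2 * (1 - q) * disc q κ.1 :=
    mul_nonneg (mul_nonneg h.snd_pos.le (by linarith [h.q_lt])) h.disc_pos.le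
  have key : ∀ n, 0 ≤ edge q κ n 1 κ.1 κ.2 ∧
      0 ≤ edge q κ (n + 1) 1 κ.1 κ.2 - edge q κ n 1 κ.1 κ.2 ∧
      r * (edge q κ (n + 1) 1 κ.1 κ.2 - edge q κ n 1 κ.1 κ.2) ≤
        edge q κ (n + 2) 1 κ.1 κ.2 - edge q κ (n + 1) 1 κ.1 κ.2 := by
    intro n
    induction n with
    | zero =>
      refine ⟨h0.ge, ?_, ?_⟩
      · rw [h0, h1]; linarith
      · rw [h2, zero_add, h0, h1]
        nlinarith
    | succ n ih =>
      obtain ⟨i1, i2, i3⟩ := ih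
      have hrec := edge_recurrence (q := q) (κ := κ) n 1 κ.1 κ.2
      refine ⟨by linarith, le_trans (mul_nonneg hr0 i2) i3, ?_⟩
      rw [hrec, ← hr]
      nlinarith
  exact (key n).1

/-- Pulling back an edge along `sigma q`. -/
theorem edge_succ_sigma {n : ℕ} {x y : ℝ} (hx : 1 - x ≠ 0) :
    edge q κ (n + 1) 1 (sigma q (x, y)).1 (sigma q (x, y)).2 =
      (1 - q) / (1 - x) * edge q κ n 1 x y := by
  rw [← edge_smul, edge, sigma]
  congr 1
  · ring
  · field_simp; ring
  · ring

theorem edge_iterate (h : Admissible q κ) (n : ℕ) :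
    edge q κ n 1 ((sigma q)^[n] κ).1 ((sigma q)^[n] κ).2 = 0 := by
  induction n with
  | zero => simp [edge]
  | succ n ih =>
    rw [Function.iterate_succ_apply', ← Prod.mk.eta (p := (sigma q)^[n] κ),
      edge_succ_sigma (h.one_sub_iterate_sigma_pos n).ne', ih, mul_zero]

theorem edge_iterate_succ (h : Admissible q κ) (n : ℕ) :
    edge q κ n 1 ((sigma q)^[n + 1] κ).1 ((sigma q)^[n + 1] κ).2 = 0 := by
  induction n with
  | zero =>
    have h1 : 1 - κ.1 ≠ 0 := (h.one_sub_iterate_sigma_pos 0).ne'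
    simp only [zero_add, Function.iterate_one, sigma, edge, disc]
    field_simp
    ring
  | succ n ih =>
    rw [Function.iterate_succ_apply', ← Prod.mk.eta (p := (sigma q)^[n + 1] κ),
      edge_succ_sigma (h.one_sub_iterate_sigma_pos (n + 1)).ne', ih, mul_zero]

/-- Two consecutive edges meet in a single point of the orbit. -/
theorem eq_of_edge_eq_zero (h : Admissible q κ) (n : ℕ) {w X Y : ℝ}
    (h1 : edge q κ n w X Y = 0) (h2 : edge q κ (n + 1) w X Y = 0) :
    X = w * ((sigma q)^[n + 1] κ).1 ∧ Y = w * ((sigma q)^[n + 1] κ).2 := by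
  induction n generalizing w X Y with
  | zero =>
    have hx : 1 - κ.1 ≠ 0 := (h.one_sub_iterate_sigma_pos 0).ne'
    have hd := h.disc_pos
    have hq := h.q_lt
    have hk := h.snd_pos
    have hk1 : 0 < 1 - κ.1 := h.one_sub_iterate_sigma_pos 0
    have e1 : X = w * ((sigma q)^[0 + 1] κ).1 := by
      simp only [zero_add, Function.iterate_one, sigma]
      have h3 : (κ.2 * (1 - q)) * (X * (1 - κ.1) - w * (1 - q)) = 0 := by
        simp only [edge, disc] at h1 h2
        linear_combination h2 - h1
      have h4 := (mul_eq_zero.1 h3).resolve_left (mul_pos hk (by linarith)).ne'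
      field_simp
      linarith
    refine ⟨e1, ?_⟩
    have h5 := h.edge_iterate_succ 0
    rw [← mul_right_inj' hd.ne']
    simp only [edge] at h1 h5
    rw [e1] at h1
    linear_combination h1 - w * h5
  | succ n ih =>
    obtain ⟨i1, i2⟩ := ih (w := X) (X := X - (1 - q) * w) (Y := Y) h1 h2
    have h3 := h.one_sub_iterate_sigma_pos (n + 1)
    have h4 := h.iterate_sigma_succ_fst (n + 1)
    have h5 := iterate_sigma_succ_snd (q := q) (κ := κ) (n + 1)
    have e1 : X = w * ((sigma q)^[n + 1 + 1] κ).1 := by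
      rw [← mul_left_inj' h3.ne']
      linear_combination i1 - w * h4
    refine ⟨e1, ?_⟩
    rw [h5, i2, e1]; ring

theorem edge_zero_iterate_nonneg (h : Admissible q κ) (n : ℕ) :
    0 ≤ edge q κ 0 1 ((sigma q)^[n] κ).1 ((sigma q)^[n] κ).2 := by
  induction n with
  | zero => simp [edge]
  | succ n ih =>
    have h1 := h.iterate_sigma_bounds n
    have h2 := h.one_sub_iterate_sigma_pos n
    have h3 := h.iterate_sigma_succ_fst n
    have h4 := iterate_sigma_succ_snd (q := q) (κ := κ) n
    obtain ⟨-, -, -, -, -, h5⟩ := h1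
    refine le_trans ih ?_
    rw [← sub_nonneg, ← mul_nonneg_iff_of_pos_right h2]
    have : (edge q κ 0 1 ((sigma q)^[n + 1] κ).1 ((sigma q)^[n + 1] κ).2 -
        edge q κ 0 1 ((sigma q)^[n] κ).1 ((sigma q)^[n] κ).2) * (1 - ((sigma q)^[n] κ).1) =
        κ.2 * (q - κ.1) * disc q ((sigma q)^[n] κ).1 -
        ((sigma q)^[n] κ).2 * (q - ((sigma q)^[n] κ).1) * disc q κ.1 := by
      simp only [edge, h4]
      generalize disc q κ.1 = d
      unfold disc
      linear_combination (-(κ.2 * (q - κ.1)) + d * ((sigma q)^[n] κ).2) * h3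
    linarith

end Admissible

end PCTL

namespace PCTL

open Minsky

/-! ### Derived connectives and their semantics -/

namespace Formula

def disj (φ ψ : Formula) : Formula := neg (conj (neg φ) (neg ψ))

def imp (φ ψ : Formula) : Formula := neg (conj φ (neg ψ))

/-- A rational number as a probability bound; values outside the unit interval are clamped. -/
def bound (r : ℚ) : Set.Icc (0 : ℚ) 1 := Set.projIcc 0 1 zero_le_one r

/-- `P(X φ) = r`. -/
def nextEq (r : ℚ) (φ : Formula) : Formula := probNext .eq (bound r) φ

/-- `P(φ₁ U^2 φ₂) = r`. -/
def untilEq (r : ℚ) (φ₁ φ₂ : Formula) : Formula := probUntlLE .eq (bound r) 2 φ₁ φ₂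

end Formula

namespace MarkovChain

open Formula

variable {M : MarkovChain} {t : M.S} {φ φ₁ φ₂ : Formula}

theorem sat_neg : M.Sat t (.neg φ) ↔ ¬ M.Sat t φ := Iff.rfl

theorem sat_conj : M.Sat t (.conj φ₁ φ₂) ↔ M.Sat t φ₁ ∧ M.Sat t φ₂ := Iff.rfl

theorem sat_tt : M.Sat t .tt := fun h => h.2 h.1

theorem sat_disj : M.Sat t (φ₁.disj φ₂) ↔ M.Sat t φ₁ ∨ M.Sat t φ₂ := by
  rw [disj, sat_neg, sat_conj, sat_neg, sat_neg]; tauto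

theorem sat_imp : M.Sat t (φ₁.imp φ₂) ↔ (M.Sat t φ₁ → M.Sat t φ₂) := by
  rw [imp, sat_neg, sat_conj, sat_neg]; tauto

theorem sat_bigConj {l : List Formula} : M.Sat t (bigConj l) ↔ ∀ φ ∈ l, M.Sat t φ := by
  induction l with
  | nil => simpa [bigConj] using sat_tt
  | cons φ l ih => simp [bigConj, sat_conj, ih]

theorem coe_bound {r : ℚ} (h0 : (0 : ℝ) ≤ r) (h1 : (r : ℝ) ≤ 1) : ((bound r : ℚ) : ℝ) = r := by
  rw [bound, Set.projIcc_of_mem zero_le_one ⟨by exact_mod_cast h0, by exact_mod_cast h1⟩]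

theorem sat_probNext {c : Cmp} {r : Set.Icc (0 : ℚ) 1} :
    M.Sat t (.probNext c r φ) ↔ c.Holds (M.stepProb t (M.sat φ)) (r : ℚ) := by
  rw [← prob_one]; rfl

theorem sat_nextEq {r : ℚ} (h0 : (0 : ℝ) ≤ r) (h1 : (r : ℝ) ≤ 1) :
    M.Sat t (nextEq r φ) ↔ M.stepProb t (M.sat φ) = r := by
  rw [nextEq, sat_probNext, Cmp.Holds, coe_bound h0 h1]

theorem sat_nextEq_zero : M.Sat t (nextEq 0 φ) ↔ ∀ u, M.Succ t u → ¬ M.Sat u φ := by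
  rw [sat_nextEq (by simp) (by simp), Rat.cast_zero, stepProb_eq_zero_iff]; rfl

theorem sat_nextEq_one : M.Sat t (nextEq 1 φ) ↔ ∀ u, M.Succ t u → M.Sat u φ := by
  rw [sat_nextEq (by simp) (by simp), Rat.cast_one, stepProb_eq_one_iff]; rfl

/-- The probability of `φ₁ U^2 φ₂`, computed by case distinction on the next state. -/
theorem sat_until_two {c : Cmp} {r : Set.Icc (0 : ℚ) 1} (h1 : M.Sat t φ₁) (h2 : ¬ M.Sat t φ₂)
    (f : M.S → ℝ)
    (hf : ∀ u, M.Succ t u → (M.Sat u φ₂ ∧ f u = 1) ∨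
      (¬ M.Sat u φ₂ ∧ M.Sat u φ₁ ∧ f u = M.stepProb u (M.sat φ₂)) ∨
      (¬ M.Sat u φ₂ ∧ ¬ M.Sat u φ₁ ∧ f u = 0)) :
    M.Sat t (.probUntlLE c r 2 φ₁ φ₂) ↔ c.Holds (M.ave t f) (r : ℚ) := by
  classical
  have e1 : M.prob t {π | ∃ j ≤ 2, π j ∈ M.sat φ₂ ∧ ∀ i < j, π i ∈ M.sat φ₁} =
      M.prob t {π | π 1 ∈ M.sat φ₂ ∨ (π 1 ∈ M.sat φ₁ ∧ π 2 ∈ M.sat φ₂)} := by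
    refine prob_congr fun π hπ => ?_
    have h1' : π 0 ∈ M.sat φ₁ := by rw [hπ.1]; exact h1
    have h2' : π 0 ∉ M.sat φ₂ := by rw [hπ.1]; exact h2
    constructor
    · rintro ⟨j, hj, hj2, hj3⟩
      interval_cases j
      · exact absurd hj2 h2'
      · exact Or.inl hj2
      · exact Or.inr ⟨hj3 1 (by norm_num), hj2⟩
    · rintro (h | h)
      · exact ⟨1, by norm_num, h, fun i hi => by interval_cases i; exact h1'⟩
      · refine ⟨2, le_rfl, h.2, fun i hi => ?_⟩
        interval_cases i
        · exact h1'
        · exact h.1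
  have e2 : M.ave t f = M.ave t fun u => if u ∈ M.sat φ₂ then 1 else
      if u ∈ M.sat φ₁ then M.stepProb u (M.sat φ₂) else 0 := by
    refine ave_congr fun u hu => ?_
    have := hf u hu
    unfold Sat at this
    rcases this with ⟨h, h'⟩ | ⟨h, h', h''⟩ | ⟨h, h', h''⟩ <;> simp [*]
  rw [e2, ← prob_two, ← e1]
  rfl

/-- The abbreviation `G_{=1} φ` means that `φ` holds in all reachable states. -/
theorem sat_alwaysAS : M.Sat t φ.alwaysAS ↔ ∀ u, M.Reachable t u → M.Sat u φ := by
  have e : M.Sat t φ.alwaysAS ↔ M.prob t {π | ∃ j, ¬ M.Sat (π j) φ} = 0 := by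
    have : {π : ℕ → M.S | ∃ j, π j ∈ M.sat (neg φ) ∧ ∀ i < j, π i ∈ M.sat tt} =
        {π | ∃ j, ¬ M.Sat (π j) φ} := by
      ext π
      exact exists_congr fun j => ⟨fun h => h.1, fun h => ⟨h, fun i _ => sat_tt⟩⟩
    rw [← this]
    simp [Sat, alwaysAS, sat, Cmp.Holds]
  rw [e]
  constructor
  · intro h u hu
    by_contra hc
    obtain ⟨n, hn⟩ := hu.exists_pos
    rw [prob_eq, measureReal_eq_zero_iff] at h
    have hs : {π : ℕ → M.S | π n = u} ⊆ {π | ∃ j, ¬ M.Sat (π j) φ} :=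
      fun π (hπ : π n = u) => ⟨n, by rw [hπ]; exact hc⟩
    exact hn.ne' (measure_mono_null hs h)
  · intro h
    rw [prob]
    have : M.Run t ∩ {π | ∃ j, ¬ M.Sat (π j) φ} = ∅ := by
      ext π
      simp only [Set.mem_inter_iff, Set.mem_ofPred_eq, Set.mem_empty_iff_false, iff_false, not_and,
        not_exists, not_not]
      exact fun hπ j => h _ (reachable_of_mem_run hπ j)
    rw [this]; simp

end MarkovChain

/-! ### The formula of a machine -/

/-- The real vector of a pair of rationals. -/
abbrev realVec (κ : ℚ × ℚ) : ℝ × ℝ := (κ.1, κ.2)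

section Formulas

open Formula

def aF : Formula := .atom .a
def bF : Formula := .atom .b

/-- The proposition of the leaves that complement the `a`-successors: in a counter state, the
probabilities of `a` and `cF` in the next state add up to `κ₁`. -/
def cF : Formula := .atom (.other 1)

/-- The proposition of the leaves that complement the `b`-successors: in a counter state, the
probabilities of `b` and `dF` in the next state add up to `κ₂`. -/
def dF : Formula := .atom (.other 2)

/-- The proposition used to weight leaves: each kind of leaf enters a goal state with a prescribed
probability. -/
def goalF : Formula := .atom (.other 3)

/-- The proposition of the verification states, which carry a counter value but no label. -/
def verF : Formula := .atom (.other 4)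

/-- The parity of a state. It separates a counter state and its leaves from the counter states
among its successors and their leaves. -/
def parityF (b : Bool) : Formula :=
  bif b then .atom (.other 0) else .neg (.atom (.other 0))

def leafF : Formula := aF.disj (bF.disj (cF.disj dF))

/-- Some label of the program holds. -/
def labF (P : Program) : Formula := .neg (noLabel P)

/-- The counter states: those with a label and the verification states. -/
def counterF (P : Program) : Formula := (labF P).disj verF

/-- Exactly the label `i` holds, among the labels of the program. -/
def onlyLabelF (P : Program) (i : ℕ) : Formula :=
  .conj (.atom (.label i)) (bigConj ((List.range P.length).map fun j =>
    if j + 1 = i then .tt else .neg (.atom (.label (j + 1)))))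

def targetF (P : Program) (L : Target) : Formula := (onlyLabelF P L.1).disj (onlyLabelF P L.2)

/-- The formula `F b`, for the parity `b` of the state. -/
def forParityF (F : Bool → Formula) : Formula :=
  .conj ((parityF true).imp (F true)) ((parityF false).imp (F false))

variable (q : ℚ) (κ : ℚ × ℚ) (P : Program)

/-- The rational version of `disc`. -/
def discQ (q x : ℚ) : ℚ := x - x ^ 2 - (1 - q)

/-- The left-hand side of an until-formula interpreted in a counter state of parity `b`: since the
counter states among the successors have the other parity, paths proceed only through successors
that satisfy `φ`. -/
def throughF (b : Bool) (φ : Formula) : Formula := (Formula.conj (counterF P) (parityF b)).disj φ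

/-- The conditions on the propositions of a state and its successors that do not depend on the
characteristic vector. -/
def basicF : Formula :=
  bigConj [aF.imp (.neg cF), bF.imp (.neg dF), bF.imp (.neg cF),
    (counterF P).imp (.conj (.neg leafF) (.neg goalF)),
    leafF.imp (nextEq 0 (leafF.disj (counterF P))),
    aF.imp (nextEq (1 - q) goalF),
    bF.imp (nextEq (discQ q κ.1) goalF),
    cF.imp (nextEq (κ.2 * (q - κ.1)) goalF),
    dF.imp (nextEq ((1 - q) * (1 - q)) goalF),
    (counterF P).imp (forParityF fun b =>
      nextEq 0 (goalF.disj ((leafF.conj (parityF !b)).disj ((counterF P).conj (parityF b)))))]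

/-- The condition on the characteristic vector in a counter state of parity `b`: the leaves
complement each other, and the vector lies above the line through `κ` and `sigma q κ`. -/
def vectorF (b : Bool) : Formula :=
  bigConj [nextEq κ.1 (aF.disj cF), nextEq κ.2 (bF.disj dF),
    .probUntlLE .ge (bound (discQ q κ.1 * κ.2)) 2 (throughF P b (bF.disj cF)) goalF]

/-- The characteristic vector is `κ`. -/
def zeroF : Formula := .conj (nextEq κ.1 aF) (nextEq κ.2 bF)

/-- In a counter state of parity `b`, the characteristic vectors of the successors satisfying `χ`
average to the preimage under `sigma q` of the characteristic vector. -/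
def decF (b : Bool) (χ : Formula) : Formula :=
  bigConj [nextEq κ.1 (χ.disj cF),
    untilEq (κ.1 - (1 - q)) (throughF P b χ) ((aF.conj (parityF !b)).disj (cF.conj (parityF b))),
    untilEq κ.2 (throughF P b χ) ((bF.conj (parityF !b)).disj (dF.conj (parityF b)))]

/-- In a counter state of parity `b`, the characteristic vectors of the labelled successors
average to the image under `sigma q` of the characteristic vector. -/
def incF (b : Bool) : Formula :=
  bigConj [
    untilEq (1 - q) (throughF P b aF) (((labF P).conj (parityF !b)).disj goalF),
    untilEq ((1 - q) * (1 - q)) (throughF P b (labF P)) (aF.conj (parityF !b)),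
    untilEq ((1 - q) * (1 - q) * κ.2) (throughF P b ((labF P).disj dF))
      ((bF.conj (parityF !b)).disj goalF)]

/-- The characteristic vector is `κ`, or the verification states among the successors represent the
decremented counter. -/
def verifyF : Formula := (zeroF κ).disj (forParityF fun b => decF q κ P b verF)

/-- The condition on a state whose instruction is `inc L`: the labelled successors average to the
image of the characteristic vector, carry labels in `L`, and all other successors never reach a
label. -/
def incInstrF (L : Target) : Formula :=
  bigConj [forParityF (incF q κ P), verifyF q κ P,
    nextEq 1 ((targetF P L).disj (noLabel P).alwaysAS)]

/-- The condition on a state whose instruction is `testDec L L'`. If the counter is `0`, then there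
are labelled successors, their vector is `κ` and their labels lie in `L`. Otherwise, the labelled
successors average to the preimage of the characteristic vector and carry labels in `L'`. -/
def testDecInstrF (L L' : Target) : Formula :=
  (bigConj [zeroF κ, .neg (nextEq 0 (labF P)),
    nextEq 1 (((targetF P L).conj (zeroF κ)).disj (noLabel P).alwaysAS)]).disj
  (bigConj [.neg (zeroF κ), forParityF fun b => decF q κ P b (labF P),
    nextEq 1 ((targetF P L').disj (noLabel P).alwaysAS)])

/-- The condition on the states whose label is that of the given instruction. -/
def instrF : Instr → Formula
  | .inc L => incInstrF q κ P L
  | .testDec L L' => testDecInstrF q κ P L L'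

/-- The instruction with label `i + 1`, with a dummy value if there is none. -/
def instrAt (i : ℕ) : Instr := P.getD i (.inc (0, 0))

/-- The conditions imposed on all reachable states. -/
def invariantF : Formula :=
  bigConj [basicF q κ P, (counterF P).imp (forParityF (vectorF q κ P)),
    verF.imp (verifyF q κ P),
    bigConj ((List.range P.length).map fun i =>
      (Formula.atom (.label (i + 1))).imp (instrF q κ P (instrAt P i)))]

/-- The formula assigned to a machine. -/
def machineF : Formula :=
  bigConj [onlyLabelF P 1, zeroF κ, (invariantF q κ P).alwaysAS]

end Formulas

namespace MarkovChain

open Formula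

variable {M : MarkovChain} {t : M.S} {P : Program} {q : ℚ} {κ : ℚ × ℚ} {b : Bool}

theorem sat_leafF : M.Sat t leafF ↔ M.Sat t aF ∨ M.Sat t bF ∨ M.Sat t cF ∨ M.Sat t dF := by
  simp only [leafF, sat_disj]

theorem sat_counterF : M.Sat t (counterF P) ↔ M.Sat t (labF P) ∨ M.Sat t verF := sat_disj

theorem sat_noLabel :
    M.Sat t (noLabel P) ↔ ∀ i ∈ Program.labels P, ¬ M.Sat t (.atom (.label i)) := by
  simp only [noLabel, sat_bigConj, List.mem_map, List.mem_range, forall_exists_index, and_imp,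
    forall_apply_eq_imp_iff₂, sat_neg]
  constructor
  · rintro h i ⟨h1, h2⟩
    have := h (i - 1) (by omega)
    rwa [Nat.sub_add_cancel h1] at this
  · intro h i hi
    exact h (i + 1) ⟨by omega, by omega⟩

theorem sat_labF :
    M.Sat t (labF P) ↔ ∃ i ∈ Program.labels P, M.Sat t (.atom (.label i)) := by
  rw [labF, sat_neg, sat_noLabel]; push Not; rfl

theorem sat_onlyLabelF {i : ℕ} : M.Sat t (onlyLabelF P i) ↔
    M.Sat t (.atom (.label i)) ∧
      ∀ j ∈ Program.labels P, j ≠ i → ¬ M.Sat t (.atom (.label j)) := by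
  simp only [onlyLabelF, sat_conj, sat_bigConj, List.mem_map, List.mem_range, forall_exists_index,
    and_imp, forall_apply_eq_imp_iff₂]
  refine and_congr_right fun _ => ?_
  constructor
  · rintro h j ⟨h1, h2⟩ hj
    have := h (j - 1) (by omega)
    rwa [Nat.sub_add_cancel h1, if_neg hj] at this
  · intro h j hj
    split_ifs with he
    · exact sat_tt
    · exact h (j + 1) ⟨by omega, by omega⟩ he

theorem sat_parityF_not : M.Sat t (parityF !b) ↔ ¬ M.Sat t (parityF b) := by
  cases b <;> simp [parityF, sat_neg]

theorem exists_sat_parityF (t : M.S) : ∃ b, M.Sat t (parityF b) := by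
  by_cases h : M.Sat t (parityF true)
  · exact ⟨true, h⟩
  · exact ⟨false, sat_parityF_not.2 h⟩

theorem sat_forParityF {F : Bool → Formula} :
    M.Sat t (forParityF F) ↔ ∀ b, M.Sat t (parityF b) → M.Sat t (F b) := by
  rw [forParityF, sat_conj, sat_imp, sat_imp, Bool.forall_bool, and_comm]

theorem sat_forParityF_iff {F : Bool → Formula} (h : M.Sat t (parityF b)) :
    M.Sat t (forParityF F) ↔ M.Sat t (F b) := by
  rw [sat_forParityF]
  refine ⟨fun hF => hF b h, fun hF b' hb' => ?_⟩
  have : b' = b := by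
    by_contra hne
    have : b' = !b := by cases b <;> cases b' <;> simp_all
    subst this
    exact sat_parityF_not.1 hb' h
  rwa [this]

theorem charVec_fst : (M.charVec t).1 = M.stepProb t (M.sat aF) := succProb_eq_stepProb t _

theorem charVec_snd : (M.charVec t).2 = M.stepProb t (M.sat bF) := succProb_eq_stepProb t _

variable (M P q κ) in
/-- The meaning of `basicF`. -/
structure Basic (u : M.S) : Prop where
  not_a_c : M.Sat u aF → ¬ M.Sat u cF
  not_b_d : M.Sat u bF → ¬ M.Sat u dF
  not_b_c : M.Sat u bF → ¬ M.Sat u cF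
  counter_not_leaf : M.Sat u (counterF P) → ¬ M.Sat u leafF
  counter_not_goal : M.Sat u (counterF P) → ¬ M.Sat u goalF
  leaf_succ : M.Sat u leafF → ∀ v, M.Succ u v → ¬ M.Sat v leafF ∧ ¬ M.Sat v (counterF P)
  a_goal : M.Sat u aF → M.stepProb u (M.sat goalF) = 1 - q
  b_goal : M.Sat u bF → M.stepProb u (M.sat goalF) = disc q κ.1
  c_goal : M.Sat u cF → M.stepProb u (M.sat goalF) = κ.2 * (q - κ.1)
  d_goal : M.Sat u dF → M.stepProb u (M.sat goalF) = (1 - q) * (1 - q)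
  succ_not_goal : M.Sat u (counterF P) → ∀ v, M.Succ u v → ¬ M.Sat v goalF
  succ_leaf : M.Sat u (counterF P) → ∀ b, M.Sat u (parityF b) → ∀ v, M.Succ u v →
    M.Sat v leafF → M.Sat v (parityF b)
  succ_counter : M.Sat u (counterF P) → ∀ b, M.Sat u (parityF b) → ∀ v, M.Succ u v →
    M.Sat v (counterF P) → M.Sat v (parityF !b)

end MarkovChain

theorem coe_discQ (q x : ℚ) : ((discQ q x : ℚ) : ℝ) = disc q x := by
  simp [discQ, disc]

/-- The constants that occur as probability bounds lie in the unit interval. -/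
theorem Admissible.bounds {q : ℝ} {κ : ℝ × ℝ} (h : Admissible q κ) :
    0 ≤ 1 - q ∧ 1 - q ≤ 1 ∧ 0 ≤ disc q κ.1 ∧ disc q κ.1 ≤ 1 ∧
    0 ≤ κ.2 * (q - κ.1) ∧ κ.2 * (q - κ.1) ≤ 1 ∧ 0 ≤ κ.1 - (1 - q) ∧ κ.1 - (1 - q) ≤ 1 := by
  have h1 := h.q_gt
  have h2 := h.q_lt
  have h3 := h.disc_pos
  have h4 := h.fst_pos
  have h5 := h.fst_lt
  have h6 := h.snd_pos
  have h7 := h.snd_lt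
  have h8 := h.sum_lt
  refine ⟨by linarith, by linarith, h3.le, ?_, mul_nonneg h6.le (by linarith), ?_, ?_, by linarith⟩
  · unfold disc; nlinarith
  · exact mul_le_one₀ h7.le (by linarith) (by linarith)
  · unfold disc at h3; nlinarith

namespace MarkovChain

open Formula

variable {M : MarkovChain} {t : M.S} {P : Program} {q : ℚ} {κ : ℚ × ℚ} {b : Bool}

theorem sat_basicF (h : Admissible q (realVec κ)) : M.Sat t (basicF q κ P) ↔ M.Basic P q κ t := by
  obtain ⟨h1, h2, h3, h4, h5, h6, -, -⟩ := h.bounds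
  have e1 : M.Sat t (nextEq (1 - q) goalF) ↔ M.stepProb t (M.sat goalF) = 1 - q := by
    rw [sat_nextEq (by push_cast; exact h1) (by push_cast; exact h2)]; push_cast; rfl
  have e2 : M.Sat t (nextEq (discQ q κ.1) goalF) ↔
      M.stepProb t (M.sat goalF) = disc q κ.1 := by
    rw [sat_nextEq (by rw [coe_discQ]; exact h3) (by rw [coe_discQ]; exact h4), coe_discQ]
  have e3 : M.Sat t (nextEq (κ.2 * (q - κ.1)) goalF) ↔
      M.stepProb t (M.sat goalF) = κ.2 * (q - κ.1) := by
    rw [sat_nextEq (by push_cast; exact h5) (by push_cast; exact h6)]; push_cast; rfl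
  have e4 : M.Sat t (nextEq ((1 - q) * (1 - q)) goalF) ↔
      M.stepProb t (M.sat goalF) = (1 - q) * (1 - q) := by
    rw [sat_nextEq (by push_cast; exact mul_nonneg h1 h1)
      (by push_cast; exact mul_le_one₀ h2 h1 h2)]
    push_cast; rfl
  simp only [basicF, sat_bigConj, List.forall_mem_cons, List.not_mem_nil, sat_imp, sat_neg,
    sat_conj, sat_nextEq_zero, e1, e2, e3, e4, sat_forParityF, sat_disj, sat_parityF_not,
    false_imp_iff, implies_true, and_true, not_or, not_and, not_not]
  constructor
  · rintro ⟨i1, i2, i3, i4, i5, i6, i7, i8, i9, i10⟩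
    exact ⟨i1, i2, i3, fun h => (i4 h).1, fun h => (i4 h).2, i5, i6, i7, i8, i9,
      fun h v hv => by
        obtain ⟨b, hb⟩ := exists_sat_parityF t
        exact (i10 h b hb v hv).1,
      fun h b hb v hv => (i10 h b hb v hv).2.1,
      fun h b hb v hv hc => sat_parityF_not.2 ((i10 h b hb v hv).2.2 hc)⟩
  · intro i
    exact ⟨i.1, i.2, i.3, fun h => ⟨i.4 h, i.5 h⟩, i.6, i.7, i.8, i.9, i.10,
      fun h b hb v hv => ⟨i.11 h v hv, i.12 h b hb v hv,
        fun hc => sat_parityF_not.1 (i.13 h b hb v hv hc)⟩⟩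

/-! ### The numerical meaning of the formulae -/

theorem ave_indicator_add {A B : Set M.S} {f g : M.S → ℝ} {C D : ℝ} (hf : ∀ u, |f u| ≤ C)
    (hg : ∀ u, |g u| ≤ D) :
    M.ave t (fun u => A.indicator f u + B.indicator g u) =
      M.ave t (A.indicator f) + M.ave t (B.indicator g) :=
  integral_add ((integrable_step hf).indicator .of_discrete)
    ((integrable_step hg).indicator .of_discrete)

theorem ave_indicator_const (A : Set M.S) (c : ℝ) :
    M.ave t (A.indicator fun _ => c) = c * M.stepProb t A := by
  rw [ave, integral_indicator_const _ .of_discrete, smul_eq_mul, mul_comm, stepProb]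

theorem abs_stepProb_le (A : Set M.S) (u : M.S) : |M.stepProb u A| ≤ 1 := by
  rw [abs_of_nonneg (stepProb_nonneg _ _)]; exact stepProb_le_one _ _

theorem abs_one_le (u : M.S) : |(1 : M.S → ℝ) u| ≤ 1 := by simp

theorem sat_throughF {φ : Formula} :
    M.Sat t (throughF P b φ) ↔ (M.Sat t (counterF P) ∧ M.Sat t (parityF b)) ∨ M.Sat t φ := by
  rw [throughF, sat_disj, sat_conj]

variable (M P q κ t b) in
/-- A counter state of parity `b` which satisfies, together with all its successors, the
basic conditions. -/
structure BasicCounter : Prop where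
  counter : M.Sat t (counterF P)
  parity : M.Sat t (parityF b)
  basic : M.Basic P q κ t
  succ : ∀ u, M.Succ t u → M.Basic P q κ u

namespace BasicCounter

theorem not_leaf (h : M.BasicCounter t P q κ b) : ¬ M.Sat t leafF :=
  h.basic.counter_not_leaf h.counter

theorem not_goal (h : M.BasicCounter t P q κ b) : ¬ M.Sat t goalF :=
  h.basic.counter_not_goal h.counter

/-- Kinds of leaves are counted one step later, through the successors satisfying `χ`, together with
the leaves of another kind among the successors. -/
theorem sat_untilEq_leaf (h : M.BasicCounter t P q κ b) {χ p p' : Formula}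
    (hχ : ∀ u, M.Sat u χ → M.Sat u (counterF P)) (hp : ∀ u, M.Sat u p → M.Sat u leafF)
    (hp' : ∀ u, M.Sat u p' → M.Sat u leafF) {r : ℚ} (h0 : (0 : ℝ) ≤ r) (h1 : (r : ℝ) ≤ 1) :
    M.Sat t (untilEq r (throughF P b χ) ((p.conj (parityF !b)).disj (p'.conj (parityF b)))) ↔
      M.ave t ((M.sat χ).indicator fun u => M.stepProb u (M.sat p)) + M.stepProb t (M.sat p') =
        r := by
  rw [untilEq, sat_until_two (f := fun u => (M.sat χ).indicator (fun u => M.stepProb u (M.sat p)) u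
    + (M.sat p').indicator 1 u), Cmp.Holds, coe_bound h0 h1,
    ave_indicator_add (abs_stepProb_le _) abs_one_le, stepProb_eq_ave]
  · exact sat_throughF.2 (Or.inl ⟨h.counter, h.parity⟩)
  · simp only [sat_disj, sat_conj]
    rintro (h2 | h2)
    · exact h.not_leaf (hp _ h2.1)
    · exact h.not_leaf (hp' _ h2.1)
  intro u hu
  have hbu := h.succ u hu
  by_cases h2 : M.Sat u p'
  · have h3 : u ∉ M.sat χ := fun hc => hbu.counter_not_leaf (hχ u hc) (hp' u h2)
    refine Or.inl ⟨sat_disj.2 (Or.inr ⟨h2, ?_⟩), ?_⟩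
    · exact h.basic.succ_leaf h.counter b h.parity u hu (hp' u h2)
    · rw [Set.indicator_of_notMem h3, Set.indicator_of_mem (show u ∈ M.sat p' from h2)]; simp
  · have hT : ¬ M.Sat u ((p.conj (parityF !b)).disj (p'.conj (parityF b))) := by
      simp only [sat_disj, sat_conj, sat_parityF_not]
      rintro (h3 | h3)
      · exact h3.2 (h.basic.succ_leaf h.counter b h.parity u hu (hp u h3.1))
      · exact h2 h3.1
    rw [Set.indicator_of_notMem (show u ∉ M.sat p' from h2), add_zero]
    by_cases h3 : M.Sat u χ
    · refine Or.inr (Or.inl ⟨hT, sat_throughF.2 (Or.inr h3), ?_⟩)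
      rw [Set.indicator_of_mem (show u ∈ M.sat χ from h3)]
      have hc := hχ u h3
      have hb := h.basic.succ_counter h.counter b h.parity u hu hc
      refine stepProb_congr fun v hv => ?_
      change M.Sat v p ↔ M.Sat v _
      simp only [sat_disj, sat_conj]
      constructor
      · exact fun h4 => Or.inl ⟨h4, hbu.succ_leaf hc _ hb v hv (hp v h4)⟩
      · rintro (h4 | h4)
        · exact h4.1
        · exact absurd h4.2 (sat_parityF_not.1 (hbu.succ_leaf hc _ hb v hv (hp' v h4.1)))
    · refine Or.inr (Or.inr ⟨hT, ?_, Set.indicator_of_notMem h3 _⟩)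
      rw [sat_throughF]
      rintro (h4 | h4)
      · exact sat_parityF_not.1 (h.basic.succ_counter h.counter b h.parity u hu h4.1) h4.2
      · exact h3 h4

theorem sat_vectorF (ha : Admissible q (realVec κ)) (h : M.BasicCounter t P q κ b) :
    M.Sat t (vectorF q κ P b) ↔
      (M.charVec t).1 + M.stepProb t (M.sat cF) = κ.1 ∧
      (M.charVec t).2 + M.stepProb t (M.sat dF) = κ.2 ∧
      0 ≤ edge q (realVec κ) 0 1 (M.charVec t).1 (M.charVec t).2 := by
  obtain ⟨h1, h2, h3, h4, h5, h6, -, -⟩ := ha.bounds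
  have e1 : M.Sat t (nextEq κ.1 (aF.disj cF)) ↔
      (M.charVec t).1 + M.stepProb t (M.sat cF) = κ.1 := by
    rw [sat_nextEq ha.fst_pos.le ha.fst_lt.le, charVec_fst, ← stepProb_union]
    · rw [stepProb_congr]
      exact fun u hu => sat_disj
    · exact fun u hu => (h.succ u hu).not_a_c
  have e2 : M.Sat t (nextEq κ.2 (bF.disj dF)) ↔
      (M.charVec t).2 + M.stepProb t (M.sat dF) = κ.2 := by
    rw [sat_nextEq ha.snd_pos.le ha.snd_lt.le, charVec_snd, ← stepProb_union]
    · rw [stepProb_congr]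
      exact fun u hu => sat_disj
    · exact fun u hu => (h.succ u hu).not_b_d
  have e3 : M.Sat t (.probUntlLE .ge (bound (discQ q κ.1 * κ.2)) 2
      (throughF P b (bF.disj cF)) goalF) ↔
      (disc q κ.1 * κ.2 : ℝ) ≤ disc q κ.1 * (M.charVec t).2 +
        κ.2 * (q - κ.1) * M.stepProb t (M.sat cF) := by
    rw [sat_until_two (f := fun u => (M.sat bF).indicator (fun _ => disc q κ.1) u
      + (M.sat cF).indicator (fun _ => κ.2 * (q - κ.1) : M.S → ℝ) u), Cmp.Holds, coe_bound,
      ave_indicator_add (fun _ => le_rfl) (fun _ => le_rfl), ave_indicator_const,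
      ave_indicator_const, charVec_snd]
    · push_cast [coe_discQ]; rfl
    · push_cast [coe_discQ]
      exact mul_nonneg h3 ha.snd_pos.le
    · push_cast [coe_discQ]
      exact mul_le_one₀ h4 ha.snd_pos.le ha.snd_lt.le
    · exact sat_throughF.2 (Or.inl ⟨h.counter, h.parity⟩)
    · exact h.not_goal
    intro u hu
    have hbu := h.succ u hu
    have hT := h.basic.succ_not_goal h.counter u hu
    refine Or.inr ?_
    by_cases hb : M.Sat u bF
    · refine Or.inl ⟨hT, sat_throughF.2 (Or.inr (sat_disj.2 (Or.inl hb))), ?_⟩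
      rw [Set.indicator_of_mem (show u ∈ M.sat bF from hb), hbu.b_goal hb,
        Set.indicator_of_notMem (show u ∉ M.sat cF from hbu.not_b_c hb), add_zero]
    rw [Set.indicator_of_notMem (show u ∉ M.sat bF from hb), zero_add]
    by_cases hc : M.Sat u cF
    · refine Or.inl ⟨hT, sat_throughF.2 (Or.inr (sat_disj.2 (Or.inr hc))), ?_⟩
      rw [Set.indicator_of_mem (show u ∈ M.sat cF from hc), hbu.c_goal hc]
    · refine Or.inr ⟨hT, ?_, Set.indicator_of_notMem hc _⟩
      rw [sat_throughF, sat_disj]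
      rintro (h4 | h4)
      · exact sat_parityF_not.1 (h.basic.succ_counter h.counter b h.parity u hu h4.1) h4.2
      · exact h4.elim hb hc
  rw [vectorF, sat_bigConj]
  simp only [List.forall_mem_cons, List.not_mem_nil, e1, e2, e3, false_imp_iff, implies_true,
    and_true]
  refine and_congr_right fun i1 => and_congr_right fun i2 => ?_
  rw [edge, ← sub_nonneg]
  have : M.stepProb t (M.sat cF) = κ.1 - (M.charVec t).1 := by linarith
  rw [this]
  refine iff_of_eq ?_
  congr 1
  ring

end BasicCounter

theorem sat_zeroF (ha : Admissible q (realVec κ)) :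
    M.Sat t (zeroF κ) ↔ M.charVec t = realVec κ := by
  rw [zeroF, sat_conj, sat_nextEq ha.fst_pos.le ha.fst_lt.le, sat_nextEq ha.snd_pos.le ha.snd_lt.le,
    ← charVec_fst, ← charVec_snd, Prod.ext_iff]

variable (M t P q) in
/-- The meaning of `decF`. -/
structure DecAverage (χ : Formula) : Prop where
  mass : M.stepProb t (M.sat χ) = (M.charVec t).1
  fst : M.ave t ((M.sat χ).indicator fun u => (M.charVec u).1) = (M.charVec t).1 - (1 - q)
  snd : M.ave t ((M.sat χ).indicator fun u => (M.charVec u).2) = (M.charVec t).2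

variable (M t P q) in
/-- The meaning of `incF`. -/
structure IncAverage : Prop where
  mass : M.stepProb t (M.sat (labF P)) = (1 - q) * (1 - (M.charVec t).1)
  fst : M.ave t ((M.sat (labF P)).indicator fun u => (M.charVec u).1) = (1 - q) * (1 - q)
  snd : M.ave t ((M.sat (labF P)).indicator fun u => (M.charVec u).2) =
    (1 - q) * (1 - q) * (M.charVec t).2

namespace BasicCounter

theorem sat_decF (ha : Admissible q (realVec κ)) (h : M.BasicCounter t P q κ b)
    (hv : M.Sat t (vectorF q κ P b)) {χ : Formula}
    (hχ : ∀ u, M.Sat u χ → M.Sat u (counterF P)) :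
    M.Sat t (decF q κ P b χ) ↔ M.DecAverage t q χ := by
  obtain ⟨h1, h2, -⟩ := (h.sat_vectorF ha).1 hv
  obtain ⟨-, -, -, -, -, -, h3, h4⟩ := ha.bounds
  have e1 : M.Sat t (nextEq κ.1 (χ.disj cF)) ↔
      M.stepProb t (M.sat χ) + M.stepProb t (M.sat cF) = κ.1 := by
    rw [sat_nextEq ha.fst_pos.le ha.fst_lt.le, ← stepProb_union]
    · rw [stepProb_congr]
      exact fun u hu => sat_disj
    · exact fun u hu h5 h6 => (h.succ u hu).counter_not_leaf (hχ u h5)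
        (sat_leafF.2 (Or.inr (Or.inr (Or.inl h6))))
  have e2 := h.sat_untilEq_leaf (p := aF) (p' := cF) hχ
    (fun u hu => sat_leafF.2 (Or.inl hu))
    (fun u hu => sat_leafF.2 (Or.inr (Or.inr (Or.inl hu)))) (r := κ.1 - (1 - q))
    (by push_cast; exact h3) (by push_cast; exact h4)
  have e3 := h.sat_untilEq_leaf (p := bF) (p' := dF) hχ
    (fun u hu => sat_leafF.2 (Or.inr (Or.inl hu)))
    (fun u hu => sat_leafF.2 (Or.inr (Or.inr (Or.inr hu)))) (r := κ.2)
    ha.snd_pos.le ha.snd_lt.le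
  simp only [← charVec_fst, ← charVec_snd] at e2 e3
  rw [decF, sat_bigConj]
  simp only [List.forall_mem_cons, List.not_mem_nil, e1, e2, e3, false_imp_iff, implies_true,
    and_true]
  push_cast
  constructor
  · rintro ⟨i1, i2, i3⟩
    exact ⟨by linarith, by linarith, by linarith⟩
  · rintro ⟨i1, i2, i3⟩
    exact ⟨by linarith, by linarith, by linarith⟩

theorem sat_incF (ha : Admissible q (realVec κ)) (h : M.BasicCounter t P q κ b)
    (hv : M.Sat t (vectorF q κ P b)) :
    M.Sat t (incF q κ P b) ↔ M.IncAverage t P q := by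
  obtain ⟨-, h2, -⟩ := (h.sat_vectorF ha).1 hv
  obtain ⟨h3, h4, -⟩ := ha.bounds
  have hlab : ∀ u, M.Sat u (labF P) → M.Sat u (counterF P) := fun u hu => sat_counterF.2 (Or.inl hu)
  have hleaf : ∀ u, M.Sat u aF → M.Sat u leafF := fun u hu => sat_leafF.2 (Or.inl hu)
  have hleafb : ∀ u, M.Sat u bF → M.Sat u leafF := fun u hu => sat_leafF.2 (Or.inr (Or.inl hu))
  have hleafd : ∀ u, M.Sat u dF → M.Sat u leafF :=
    fun u hu => sat_leafF.2 (Or.inr (Or.inr (Or.inr hu)))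
  have hnc : ∀ u, M.Succ t u → ¬ (M.Sat u (counterF P) ∧ M.Sat u (parityF b)) := fun u hu hc =>
    sat_parityF_not.1 (h.basic.succ_counter h.counter b h.parity u hu hc.1) hc.2
  have e1 : M.Sat t (untilEq (1 - q) (throughF P b aF)
      (((labF P).conj (parityF !b)).disj goalF)) ↔
      M.stepProb t (M.sat (labF P)) + (1 - q) * (M.charVec t).1 = 1 - q := by
    rw [untilEq, sat_until_two (f := fun u => (M.sat (labF P)).indicator 1 u
      + (M.sat aF).indicator (fun _ => 1 - q : M.S → ℝ) u), Cmp.Holds, coe_bound,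
      ave_indicator_add abs_one_le (fun _ => le_rfl), ave_indicator_const,
      ← stepProb_eq_ave, charVec_fst]
    · push_cast; rfl
    · push_cast; exact h3
    · push_cast; exact h4
    · exact sat_throughF.2 (Or.inl ⟨h.counter, h.parity⟩)
    · rw [sat_disj, sat_conj, sat_parityF_not]
      exact fun hc => hc.elim (fun hc => hc.2 h.parity) h.not_goal
    intro u hu
    have hbu := h.succ u hu
    by_cases h5 : M.Sat u (labF P)
    · have h6 : u ∉ M.sat aF := fun hc => hbu.counter_not_leaf (hlab u h5) (hleaf u hc)
      refine Or.inl ⟨sat_disj.2 (Or.inl ⟨h5, ?_⟩), ?_⟩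
      · exact h.basic.succ_counter h.counter b h.parity u hu (hlab u h5)
      · rw [Set.indicator_of_notMem h6, Set.indicator_of_mem (show u ∈ M.sat (labF P) from h5)]
        simp
    refine Or.inr ?_
    have hT : ¬ M.Sat u (((labF P).conj (parityF !b)).disj goalF) := by
      rw [sat_disj, sat_conj]
      exact fun hc => hc.elim (fun hc => h5 hc.1) (h.basic.succ_not_goal h.counter u hu)
    rw [Set.indicator_of_notMem (show u ∉ M.sat (labF P) from h5), zero_add]
    by_cases h6 : M.Sat u aF
    · refine Or.inl ⟨hT, sat_throughF.2 (Or.inr h6), ?_⟩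
      rw [Set.indicator_of_mem (show u ∈ M.sat aF from h6), ← hbu.a_goal h6]
      refine stepProb_congr fun v hv => ?_
      change M.Sat v goalF ↔ M.Sat v _
      rw [sat_disj, sat_conj]
      exact ⟨Or.inr, fun hc => hc.elim
        (fun hc => absurd (hlab v hc.1) (hbu.leaf_succ (hleaf u h6) v hv).2) id⟩
    · refine Or.inr ⟨hT, ?_, Set.indicator_of_notMem h6 _⟩
      rw [sat_throughF]
      exact fun hc => hc.elim (hnc u hu) h6
  have e2 : M.Sat t (untilEq ((1 - q) * (1 - q)) (throughF P b (labF P))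
      (aF.conj (parityF !b))) ↔
      M.ave t ((M.sat (labF P)).indicator fun u => (M.charVec u).1) = (1 - q) * (1 - q) := by
    rw [untilEq, sat_until_two (f := (M.sat (labF P)).indicator fun u => (M.charVec u).1),
      Cmp.Holds, coe_bound]
    · push_cast; rfl
    · push_cast; exact mul_nonneg h3 h3
    · push_cast; exact mul_le_one₀ h4 h3 h4
    · exact sat_throughF.2 (Or.inl ⟨h.counter, h.parity⟩)
    · rw [sat_conj, sat_parityF_not]
      exact fun hc => hc.2 h.parity
    intro u hu
    have hbu := h.succ u hu
    refine Or.inr ?_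
    have hT : ¬ M.Sat u (aF.conj (parityF !b)) := by
      rw [sat_conj, sat_parityF_not]
      exact fun hc => hc.2 (h.basic.succ_leaf h.counter b h.parity u hu (hleaf u hc.1))
    by_cases h5 : M.Sat u (labF P)
    · refine Or.inl ⟨hT, sat_throughF.2 (Or.inr h5), ?_⟩
      rw [Set.indicator_of_mem (show u ∈ M.sat (labF P) from h5), charVec_fst]
      have hb := h.basic.succ_counter h.counter b h.parity u hu (hlab u h5)
      refine stepProb_congr fun v hv => ?_
      change M.Sat v aF ↔ M.Sat v _
      rw [sat_conj]
      exact ⟨fun hc => ⟨hc, hbu.succ_leaf (hlab u h5) _ hb v hv (hleaf v hc)⟩, fun hc => hc.1⟩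
    · refine Or.inr ⟨hT, ?_, Set.indicator_of_notMem h5 _⟩
      rw [sat_throughF]
      exact fun hc => hc.elim (hnc u hu) h5
  have e3 : M.Sat t (untilEq ((1 - q) * (1 - q) * κ.2) (throughF P b ((labF P).disj dF))
      ((bF.conj (parityF !b)).disj goalF)) ↔
      M.ave t ((M.sat (labF P)).indicator fun u => (M.charVec u).2) +
        (1 - q) * (1 - q) * M.stepProb t (M.sat dF) = (1 - q) * (1 - q) * κ.2 := by
    rw [untilEq, sat_until_two (f := fun u =>
      (M.sat (labF P)).indicator (fun u => M.stepProb u (M.sat bF)) u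
      + (M.sat dF).indicator (fun _ => (1 - q) * (1 - q) : M.S → ℝ) u), Cmp.Holds, coe_bound,
      ave_indicator_add (abs_stepProb_le _) (fun _ => le_rfl), ave_indicator_const]
    · simp only [charVec_snd]; push_cast; rfl
    · push_cast; exact mul_nonneg (mul_nonneg h3 h3) ha.snd_pos.le
    · push_cast
      exact mul_le_one₀ (mul_le_one₀ h4 h3 h4) ha.snd_pos.le ha.snd_lt.le
    · exact sat_throughF.2 (Or.inl ⟨h.counter, h.parity⟩)
    · rw [sat_disj, sat_conj, sat_parityF_not]
      exact fun hc => hc.elim (fun hc => hc.2 h.parity) h.not_goal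
    intro u hu
    have hbu := h.succ u hu
    refine Or.inr ?_
    have hT : ¬ M.Sat u ((bF.conj (parityF !b)).disj goalF) := by
      rw [sat_disj, sat_conj, sat_parityF_not]
      exact fun hc => hc.elim
        (fun hc => hc.2 (h.basic.succ_leaf h.counter b h.parity u hu (hleafb u hc.1)))
        (h.basic.succ_not_goal h.counter u hu)
    by_cases h5 : M.Sat u (labF P)
    · have h6 : u ∉ M.sat dF := fun hc => hbu.counter_not_leaf (hlab u h5) (hleafd u hc)
      refine Or.inl ⟨hT, sat_throughF.2 (Or.inr (sat_disj.2 (Or.inl h5))), ?_⟩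
      rw [Set.indicator_of_mem (show u ∈ M.sat (labF P) from h5), Set.indicator_of_notMem h6,
        add_zero]
      have hb := h.basic.succ_counter h.counter b h.parity u hu (hlab u h5)
      refine stepProb_congr fun v hv => ?_
      change M.Sat v bF ↔ M.Sat v _
      rw [sat_disj, sat_conj]
      exact ⟨fun hc => Or.inl ⟨hc, hbu.succ_leaf (hlab u h5) _ hb v hv (hleafb v hc)⟩,
        fun hc => hc.elim (fun hc => hc.1)
          (fun hc => absurd hc (hbu.succ_not_goal (hlab u h5) v hv))⟩
    rw [Set.indicator_of_notMem (show u ∉ M.sat (labF P) from h5), zero_add]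
    by_cases h6 : M.Sat u dF
    · refine Or.inl ⟨hT, sat_throughF.2 (Or.inr (sat_disj.2 (Or.inr h6))), ?_⟩
      rw [Set.indicator_of_mem (show u ∈ M.sat dF from h6), ← hbu.d_goal h6]
      refine stepProb_congr fun v hv => ?_
      change M.Sat v goalF ↔ M.Sat v _
      rw [sat_disj, sat_conj]
      exact ⟨Or.inr, fun hc => hc.elim
        (fun hc => absurd (hleafb v hc.1) (hbu.leaf_succ (hleafd u h6) v hv).1) id⟩
    · refine Or.inr ⟨hT, ?_, Set.indicator_of_notMem h6 _⟩
      rw [sat_throughF, sat_disj]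
      exact fun hc => hc.elim (hnc u hu) (fun hc => hc.elim h5 h6)
  rw [incF, sat_bigConj]
  simp only [List.forall_mem_cons, List.not_mem_nil, e1, e2, e3, false_imp_iff, implies_true,
    and_true]
  have h5 : M.stepProb t (M.sat dF) = κ.2 - (M.charVec t).2 := by linarith
  rw [h5]
  constructor
  · rintro ⟨i1, i2, i3⟩
    exact ⟨by linarith, i2, by linarith⟩
  · rintro ⟨i1, i2, i3⟩
    exact ⟨by linarith, i2, by linarith⟩

end BasicCounter

/-! ### The meaning of the invariant -/

variable (M t P q κ) in
/-- The meaning of `instrF`. -/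
def InstrMeaning : Instr → Prop
  | .inc L => M.IncAverage t P q ∧ (M.charVec t = realVec κ ∨ M.DecAverage t q verF) ∧
      ∀ u, M.Succ t u → M.Sat u (targetF P L) ∨ M.Sat u (noLabel P).alwaysAS
  | .testDec L L' => (M.charVec t = realVec κ ∧ (∃ u, M.Succ t u ∧ M.Sat u (labF P)) ∧
        ∀ u, M.Succ t u → (M.Sat u (targetF P L) ∧ M.charVec u = realVec κ) ∨
          M.Sat u (noLabel P).alwaysAS) ∨
      (M.charVec t ≠ realVec κ ∧ M.DecAverage t q (labF P) ∧
        ∀ u, M.Succ t u → M.Sat u (targetF P L') ∨ M.Sat u (noLabel P).alwaysAS)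

variable (M t P q κ) in
/-- The meaning of `invariantF`. -/
structure Invariant : Prop where
  basic : M.Basic P q κ t
  vector : M.Sat t (counterF P) →
    (M.charVec t).1 + M.stepProb t (M.sat cF) = κ.1 ∧
    (M.charVec t).2 + M.stepProb t (M.sat dF) = κ.2 ∧
    0 ≤ edge q (realVec κ) 0 1 (M.charVec t).1 (M.charVec t).2
  verify : M.Sat t verF → M.charVec t = realVec κ ∨ M.DecAverage t q verF
  instr : ∀ i < P.length, M.Sat t (.atom (.label (i + 1))) →
    M.InstrMeaning t P q κ (instrAt P i)

theorem sat_counterF_of_label {i : ℕ} (hi : i < P.length)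
    (h : M.Sat t (.atom (.label (i + 1)))) : M.Sat t (counterF P) :=
  sat_counterF.2 (Or.inl (sat_labF.2 ⟨i + 1, ⟨by omega, by omega⟩, h⟩))

theorem sat_counterF_of_lab (u : M.S) (h : M.Sat u (labF P)) : M.Sat u (counterF P) :=
  sat_counterF.2 (Or.inl h)

theorem sat_counterF_of_ver (u : M.S) (h : M.Sat u verF) : M.Sat u (counterF P) :=
  sat_counterF.2 (Or.inr h)

theorem sat_verifyF (ha : Admissible q (realVec κ)) (h : M.BasicCounter t P q κ b)
    (hv : M.Sat t (vectorF q κ P b)) :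
    M.Sat t (verifyF q κ P) ↔ M.charVec t = realVec κ ∨ M.DecAverage t q verF := by
  rw [verifyF, sat_disj, sat_zeroF ha, sat_forParityF_iff h.parity,
    h.sat_decF ha hv sat_counterF_of_ver]

theorem sat_instrF (ha : Admissible q (realVec κ)) (h : M.BasicCounter t P q κ b)
    (hv : M.Sat t (vectorF q κ P b)) (ins : Instr) :
    M.Sat t (instrF q κ P ins) ↔ M.InstrMeaning t P q κ ins := by
  cases ins with
  | inc L =>
    rw [instrF, incInstrF, sat_bigConj]
    simp only [List.forall_mem_cons, List.not_mem_nil, false_imp_iff, implies_true, and_true]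
    rw [sat_verifyF ha h hv, sat_forParityF_iff h.parity, h.sat_incF ha hv, sat_nextEq_one]
    simp only [sat_disj]
    rfl
  | testDec L L' =>
    rw [instrF, testDecInstrF, sat_disj, sat_bigConj, sat_bigConj]
    simp only [List.forall_mem_cons, List.not_mem_nil, false_imp_iff, implies_true, and_true]
    rw [sat_neg, sat_neg, sat_zeroF ha, sat_forParityF_iff h.parity,
      h.sat_decF ha hv sat_counterF_of_lab, sat_nextEq_one, sat_nextEq_one, sat_nextEq_zero]
    simp only [sat_disj, sat_conj, sat_zeroF ha]
    push Not
    rfl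

theorem sat_invariantF (ha : Admissible q (realVec κ))
    (hs : ∀ u, M.Succ t u → M.Basic P q κ u) :
    M.Sat t (invariantF q κ P) ↔ M.Invariant t P q κ := by
  obtain ⟨b, hb⟩ := exists_sat_parityF t
  rw [invariantF, sat_bigConj]
  simp only [List.forall_mem_cons, List.not_mem_nil, false_imp_iff, implies_true, and_true,
    sat_basicF ha, sat_imp, sat_forParityF_iff hb]
  rw [sat_bigConj]
  simp only [List.mem_map, List.mem_range, forall_exists_index, and_imp,
    forall_apply_eq_imp_iff₂, sat_imp]
  constructor
  · rintro ⟨h1, h2, h3, h4⟩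
    have hbc : ∀ hc : M.Sat t (counterF P), M.BasicCounter t P q κ b := fun hc => ⟨hc, hb, h1, hs⟩
    exact ⟨h1, fun hc => ((hbc hc).sat_vectorF ha).1 (h2 hc),
      fun hv => (sat_verifyF ha (hbc (sat_counterF_of_ver _ hv))
        (h2 (sat_counterF_of_ver _ hv))).1 (h3 hv),
      fun i hi hl => (sat_instrF ha (hbc (sat_counterF_of_label hi hl))
        (h2 (sat_counterF_of_label hi hl)) _).1 (h4 i hi hl)⟩
  · rintro ⟨h1, h2, h3, h4⟩
    have hbc : ∀ hc : M.Sat t (counterF P), M.BasicCounter t P q κ b := fun hc => ⟨hc, hb, h1, hs⟩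
    have hv : ∀ hc : M.Sat t (counterF P), M.Sat t (vectorF q κ P b) :=
      fun hc => ((hbc hc).sat_vectorF ha).2 (h2 hc)
    exact ⟨h1, hv,
      fun hv' => (sat_verifyF ha (hbc (sat_counterF_of_ver _ hv'))
        (hv (sat_counterF_of_ver _ hv'))).2 (h3 hv'),
      fun i hi hl => (sat_instrF ha (hbc (sat_counterF_of_label hi hl))
        (hv (sat_counterF_of_label hi hl)) _).2 (h4 i hi hl)⟩

theorem sat_machineF (ha : Admissible q (realVec κ)) :
    M.Sat t (machineF q κ P) ↔ M.Sat t (onlyLabelF P 1) ∧ M.charVec t = realVec κ ∧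
      ∀ u, M.Reachable t u → M.Invariant u P q κ := by
  rw [machineF, sat_bigConj]
  simp only [List.forall_mem_cons, List.not_mem_nil, false_imp_iff, implies_true, and_true,
    sat_zeroF ha, sat_alwaysAS]
  refine and_congr_right fun _ => and_congr_right fun _ => ?_
  constructor
  · intro h u hu
    have hb : ∀ u, M.Reachable t u → M.Basic P q κ u := fun u hu =>
      (sat_basicF ha).1 (sat_bigConj.1 (h u hu) _ (by simp))
    exact (sat_invariantF ha fun v hv => hb v (hu.of_succ hv)).1 (h u hu)
  · exact fun h u hu => (sat_invariantF ha fun v hv => (h v (hu.of_succ hv)).basic).2 (h u hu)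

/-! ### Averages of points of the orbit -/

theorem abs_charVec_fst_le (u : M.S) : |(M.charVec u).1| ≤ 1 := by
  rw [charVec_fst]; exact abs_stepProb_le _ _

theorem abs_charVec_snd_le (u : M.S) : |(M.charVec u).2| ≤ 1 := by
  rw [charVec_snd]; exact abs_stepProb_le _ _

/-- The weight of a set of successors and the weighted sums of the coordinates of their
characteristic vectors determine the weighted sum of an edge form. -/
theorem ave_indicator_edge (A : Set M.S) (n : ℕ) (q : ℝ) (κ : ℝ × ℝ) :
    M.ave t (A.indicator fun u => edge q κ n 1 (M.charVec u).1 (M.charVec u).2) =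
      edge q κ n (M.stepProb t A) (M.ave t (A.indicator fun u => (M.charVec u).1))
        (M.ave t (A.indicator fun u => (M.charVec u).2)) := by
  obtain ⟨α, β, γ, h⟩ := exists_edge_eq q κ n
  have i1 : Integrable (A.indicator fun u => (M.charVec u).1) (M.step t).toMeasure :=
    (integrable_step abs_charVec_fst_le).indicator .of_discrete
  have i2 : Integrable (A.indicator fun u => (M.charVec u).2) (M.step t).toMeasure :=
    (integrable_step abs_charVec_snd_le).indicator .of_discrete
  have i3 : Integrable (A.indicator 1) (M.step t).toMeasure :=
    (integrable_step (C := 1) abs_one_le).indicator .of_discrete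
  have i4 : Integrable (fun u => α * A.indicator 1 u + β * A.indicator (fun u => (M.charVec u).1) u)
      (M.step t).toMeasure := (i3.const_mul _).add (i1.const_mul _)
  have e : (A.indicator fun u => edge q κ n 1 (M.charVec u).1 (M.charVec u).2) =
      fun u => α * A.indicator 1 u + β * A.indicator (fun u => (M.charVec u).1) u +
        γ * A.indicator (fun u => (M.charVec u).2) u := by
    funext u
    by_cases hu : u ∈ A <;> simp [hu, h]
  rw [h, e, stepProb_eq_ave, ave, ave, ave, ave,
    integral_add i4 (i2.const_mul _),
    integral_add (i3.const_mul _) (i1.const_mul _), integral_const_mul, integral_const_mul,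
    integral_const_mul]

theorem ave_indicator_nonneg {A : Set M.S} {f : M.S → ℝ}
    (h : ∀ u, M.Succ t u → u ∈ A → 0 ≤ f u) : 0 ≤ M.ave t (A.indicator f) :=
  integral_nonneg_of_ae (ae_step_iff.2 fun u hu => Set.indicator_apply_nonneg (h u hu))

theorem eq_zero_of_ave_indicator_eq_zero {A : Set M.S} {f : M.S → ℝ} {C : ℝ}
    (hC : ∀ u, |f u| ≤ C) (h : ∀ u, M.Succ t u → u ∈ A → 0 ≤ f u)
    (h0 : M.ave t (A.indicator f) = 0) {u : M.S} (hu : M.Succ t u) (hA : u ∈ A) : f u = 0 := by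
  have h1 := (integral_eq_zero_iff_of_nonneg_ae
    (ae_step_iff.2 fun u hu => Set.indicator_apply_nonneg (h u hu))
    ((integrable_step hC).indicator .of_discrete)).1 h0
  have h2 : A.indicator f u = 0 := ae_step_iff.1 h1 u hu
  rwa [Set.indicator_of_mem hA] at h2

theorem abs_edge_charVec_le (n : ℕ) (q : ℝ) (κ : ℝ × ℝ) :
    ∃ C, ∀ u, |edge q κ n 1 (M.charVec u).1 (M.charVec u).2| ≤ C := by
  obtain ⟨α, β, γ, h⟩ := exists_edge_eq q κ n
  refine ⟨|α| + |β| + |γ|, fun u => ?_⟩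
  rw [h]
  refine (abs_add_three _ _ _).trans ?_
  rw [abs_mul, abs_mul, abs_mul, abs_one, mul_one]
  gcongr
  · exact mul_le_of_le_one_right (abs_nonneg _) (abs_charVec_fst_le u)
  · exact mul_le_of_le_one_right (abs_nonneg _) (abs_charVec_snd_le u)

/-- A point of the orbit of `κ` is an extreme point of the region that is cut out by all edges and
the line `x = κ₁`: if it is an average of points of that region, then it equals all of them. -/
theorem charVec_eq_of_average {q : ℝ} {κ : ℝ × ℝ} (ha : Admissible q κ) {A : Set M.S}
    (hedge : ∀ n u, M.Succ t u → u ∈ A → 0 ≤ edge q κ n 1 (M.charVec u).1 (M.charVec u).2)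
    (hfst : ∀ u, M.Succ t u → u ∈ A → (M.charVec u).1 ≤ κ.1) {n : ℕ} {c : ℝ}
    (h1 : M.stepProb t A = c)
    (h2 : M.ave t (A.indicator fun u => (M.charVec u).1) = c * ((sigma q)^[n] κ).1)
    (h3 : M.ave t (A.indicator fun u => (M.charVec u).2) = c * ((sigma q)^[n] κ).2)
    {u : M.S} (hu : M.Succ t u) (hA : u ∈ A) : M.charVec u = (sigma q)^[n] κ := by
  have key : ∀ k, edge q κ k 1 ((sigma q)^[n] κ).1 ((sigma q)^[n] κ).2 = 0 →
      edge q κ k 1 (M.charVec u).1 (M.charVec u).2 = 0 := by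
    intro k hk
    obtain ⟨C, hC⟩ := abs_edge_charVec_le (M := M) k q κ
    refine eq_zero_of_ave_indicator_eq_zero hC (hedge k) ?_ hu hA
    rw [ave_indicator_edge, h1, h2, h3, ← mul_one c, mul_assoc, mul_assoc, edge_smul, one_mul,
      one_mul, hk, mul_zero]
  cases n with
  | zero =>
    have e0 := key 0 (ha.edge_iterate 0)
    have e1 : κ.1 - (M.charVec u).1 = 0 := by
      refine eq_zero_of_ave_indicator_eq_zero (f := fun u => κ.1 - (M.charVec u).1) (C := |κ.1| + 1)
        (fun u => ?_) (fun u hu hA => sub_nonneg.2 (hfst u hu hA)) ?_ hu hA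
      · exact (abs_sub _ _).trans (add_le_add_right (abs_charVec_fst_le u) _)
      · have e : (A.indicator fun u => κ.1 - (M.charVec u).1) =
            fun u => A.indicator (fun _ => κ.1) u - A.indicator (fun u => (M.charVec u).1) u := by
          funext v
          by_cases hv : v ∈ A <;> simp [hv]
        rw [e, ave, integral_sub]
        · change M.ave t (A.indicator fun _ => κ.1) - M.ave t _ = 0
          rw [ave_indicator_const, h1, h2, Function.iterate_zero_apply, mul_comm, sub_self]
        · exact (integrable_const _).indicator .of_discrete
        · exact (integrable_step abs_charVec_fst_le).indicator .of_discrete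
    have e2 : (M.charVec u).1 = κ.1 := by linarith
    refine Prod.ext e2 ?_
    rw [edge, e2] at e0
    have e3 : disc q κ.1 * (κ.2 - (M.charVec u).2) = 0 := by linear_combination -e0
    have := (mul_eq_zero.1 e3).resolve_left ha.disc_pos.ne'
    simp only [Function.iterate_zero_apply]
    linarith
  | succ n =>
    have e := ha.eq_of_edge_eq_zero n (key n (ha.edge_iterate_succ n))
      (key (n + 1) (ha.edge_iterate (n + 1)))
    rw [one_mul, one_mul] at e
    exact Prod.ext e.1 e.2

/-! ### Soundness: every model simulates the machine -/

theorem Invariant.exists_decAverage (h : M.Invariant t P q κ)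
    (hc : M.Sat t (counterF P)) : M.charVec t = realVec κ ∨
      ∃ χ : Formula, (∀ u, M.Sat u χ → M.Sat u (counterF P)) ∧ M.DecAverage t q χ := by
  rcases sat_counterF.1 hc with hl | hv
  · obtain ⟨i, hi, hil⟩ := sat_labF.1 hl
    obtain ⟨i, rfl⟩ := Nat.exists_eq_add_of_le' hi.1
    have hm := h.instr i (by have := hi.2; omega) hil
    cases hins : instrAt P i with
    | inc L =>
      rw [hins] at hm
      exact hm.2.1.imp_right fun hd => ⟨verF, sat_counterF_of_ver, hd⟩
    | testDec L L' =>
      rw [hins] at hm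
      rcases hm with hm | hm
      · exact Or.inl hm.1
      · exact Or.inr ⟨labF P, sat_counterF_of_lab, hm.2.1⟩
  · exact (h.verify hv).imp_right fun hd => ⟨verF, sat_counterF_of_ver, hd⟩

theorem edge_charVec_nonneg (ha : Admissible q (realVec κ)) {s : M.S}
    (h : ∀ u, M.Reachable s u → M.Invariant u P q κ) (n : ℕ) {u : M.S} (hu : M.Reachable s u)
    (hc : M.Sat u (counterF P)) :
    0 ≤ edge q (realVec κ) n 1 (M.charVec u).1 (M.charVec u).2 := by
  induction n generalizing u with
  | zero => exact ((h u hu).vector hc).2.2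
  | succ n ih =>
    rcases (h u hu).exists_decAverage hc with h1 | ⟨χ, hχ, hd⟩
    · rw [h1]; exact ha.edge_self_nonneg (n + 1)
    · have e := ave_indicator_edge (t := u) (M.sat χ) n (q : ℝ) (realVec κ)
      rw [hd.mass, hd.fst, hd.snd] at e
      rw [edge, mul_one, ← e]
      exact ave_indicator_nonneg fun v hv hv' => ih (hu.of_succ hv) (hχ v hv')

theorem not_labF_of_alwaysAS (h : M.Sat t (noLabel P).alwaysAS) : ¬ M.Sat t (labF P) :=
  fun hl => hl (sat_alwaysAS.1 h t Relation.ReflTransGen.refl)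

theorem represents_of_targetF {L : Target} (hL : L.labels ⊆ Program.labels P)
    (h : M.Sat t (targetF P L)) {n : ℕ} (hn : M.charVec t = (sigma q)^[n] (realVec κ)) :
    ∃ i ∈ L.labels, M.Represents q (realVec κ) P t (i, n) := by
  rcases sat_disj.1 h with h | h
  · exact ⟨L.1, Or.inl rfl, hL (Or.inl rfl), (sat_onlyLabelF.1 h).1, (sat_onlyLabelF.1 h).2, hn⟩
  · exact ⟨L.2, Or.inr rfl, hL (Or.inr rfl), (sat_onlyLabelF.1 h).1, (sat_onlyLabelF.1 h).2, hn⟩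

theorem simulates_of_sat_machineF (ha : Admissible q (realVec κ)) (hP : P.IsMachine) {s : M.S}
    (hs : M.Sat s (machineF q κ P)) : M.Simulates q (realVec κ) P s := by
  obtain ⟨h1, h2, hinv⟩ := (sat_machineF ha).1 hs
  refine ⟨⟨⟨le_rfl, hP.1⟩, (sat_onlyLabelF.1 h1).1, (sat_onlyLabelF.1 h1).2, h2⟩, ?_⟩
  rintro t ht ⟨i, n⟩ ⟨⟨hi1, hi2⟩, hil, -, hv⟩
  simp only at hi1 hi2 hil hv
  obtain ⟨i, rfl⟩ := Nat.exists_eq_add_of_le' hi1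
  have hiP : i < P.length := by omega
  have hm := (hinv t ht).instr i hiP hil
  have hget : P[i + 1 - 1]? = some (instrAt P i) := by
    simp [instrAt, List.getD_eq_getElem?_getD, hiP]
  have hmem : instrAt P i ∈ P := by
    have := List.mem_of_getElem? hget
    exact this
  have hlabels := hP.2 _ hmem
  have hstep : ∀ {C' : Config}, (instrAt P i).Performs n C' → Program.Step P (i + 1, n) C' :=
    fun h => ⟨_, hi1, hget, h⟩
  clear hmem hget
  have hcv := fun u (hu : M.Succ t u) (hc : M.Sat u (counterF P)) =>
    (hinv u (ht.of_succ hu)).vector hc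
  have hedge : ∀ k u, M.Succ t u → u ∈ M.sat (labF P) →
      0 ≤ edge q (realVec κ) k 1 (M.charVec u).1 (M.charVec u).2 :=
    fun k u hu hl => edge_charVec_nonneg ha hinv k (ht.of_succ hu) (sat_counterF_of_lab _ hl)
  have hfst : ∀ u, M.Succ t u → u ∈ M.sat (labF P) → (M.charVec u).1 ≤ (realVec κ).1 := by
    intro u hu hl
    have := (hcv u hu (sat_counterF_of_lab _ hl)).1
    have := stepProb_nonneg (M := M) u (M.sat cF)
    linarith
  -- if the labelled successors lie on the orbit, and the other ones are quiet, it remains to find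
  -- a labelled successor
  have finish : ∀ (L : Target) (n' : ℕ), L.labels ⊆ Program.labels P →
      (∀ i' ∈ L.labels, (instrAt P i).Performs n (i', n')) →
      (∀ u, M.Succ t u → M.Sat u (labF P) → M.charVec u = (sigma q)^[n'] (realVec κ)) →
      (∀ u, M.Succ t u → M.Sat u (targetF P L) ∨ M.Sat u (noLabel P).alwaysAS) →
      (∃ u, M.Succ t u ∧ M.Sat u (labF P)) →
      (∃ t', M.Succ t t' ∧ M.RepresentsSuccOf q (realVec κ) P t' (i + 1, n)) ∧
      ∀ t', M.Succ t t' → ¬ M.RepresentsSuccOf q (realVec κ) P t' (i + 1, n) →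
        M.Sat t' (noLabel P).alwaysAS := by
    intro L n' hL hperf hvec htgt ⟨u, hu, hul⟩
    have hrep : ∀ v, M.Succ t v → M.Sat v (targetF P L) →
        M.RepresentsSuccOf q (realVec κ) P v (i + 1, n) := by
      intro v hv hvt
      have hvl : M.Sat v (labF P) := by
        rcases sat_disj.1 hvt with h | h
        · exact sat_labF.2 ⟨L.1, hL (Or.inl rfl), (sat_onlyLabelF.1 h).1⟩
        · exact sat_labF.2 ⟨L.2, hL (Or.inr rfl), (sat_onlyLabelF.1 h).1⟩
      obtain ⟨i', hi', hr⟩ := represents_of_targetF hL hvt (hvec v hv hvl)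
      exact ⟨_, hstep (hperf i' hi'), hr⟩
    refine ⟨⟨u, hu, ?_⟩, fun v hv hnr => ?_⟩
    · exact hrep u hu ((htgt u hu).resolve_right fun h => not_labF_of_alwaysAS h hul)
    · exact (htgt v hv).resolve_left fun h => hnr (hrep v hv h)
  have hexists : 0 < M.stepProb t (M.sat (labF P)) → ∃ u, M.Succ t u ∧ M.Sat u (labF P) := by
    intro hpos
    by_contra hc
    push Not at hc
    exact hpos.ne' (stepProb_eq_zero_iff.2 hc)
  cases hins : instrAt P i with
  | inc L =>
    rw [hins] at hm hlabels
    obtain ⟨hI, -, htgt⟩ := hm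
    have e1 := ha.iterate_sigma_succ_fst n
    have e2 := Admissible.iterate_sigma_succ_snd (q := (q : ℝ)) (κ := realVec κ) n
    have m1 := hI.mass
    have m2 := hI.fst
    have m3 := hI.snd
    rw [hv] at m1 m3
    refine finish L (n + 1) hlabels (fun i' hi' => by rw [hins]; exact ⟨hi', rfl⟩) ?_ htgt
      (hexists ?_)
    · intro u hu hl
      refine charVec_eq_of_average ha hedge hfst m1 ?_ ?_ hu hl
      · rw [m2, ← e1]; ring
      · rw [m3, e2]; linear_combination (-(1 - (q : ℝ)) * ((sigma q)^[n] (realVec κ)).2) * e1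
    · rw [m1]
      exact mul_pos (by linarith [ha.q_lt]) (ha.one_sub_iterate_sigma_pos n)
  | testDec L L' =>
    rw [hins] at hm hlabels
    rcases hm with ⟨hz, hex, htgt⟩ | ⟨hz, hD, htgt⟩
    · rw [hv, ha.iterate_sigma_eq_self_iff] at hz
      refine finish L 0 hlabels.1
        (fun i' hi' => by rw [hins]; exact Or.inl ⟨hz, hi', rfl⟩) ?_ ?_ hex
      · exact fun u hu hl => ((htgt u hu).resolve_right
          fun h => not_labF_of_alwaysAS h hl).2
      · exact fun u hu => (htgt u hu).imp_left fun h => h.1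
    · rw [hv, ne_eq, ha.iterate_sigma_eq_self_iff] at hz
      obtain ⟨n, rfl⟩ := Nat.exists_eq_succ_of_ne_zero hz
      have e1 := ha.iterate_sigma_succ_fst n
      have e2 := Admissible.iterate_sigma_succ_snd (q := (q : ℝ)) (κ := realVec κ) n
      have m1 := hD.mass
      have m2 := hD.fst
      have m3 := hD.snd
      rw [hv] at m1 m2 m3
      refine finish L' n hlabels.2
        (fun i' hi' => by rw [hins]; exact Or.inr ⟨hz, hi', rfl⟩) ?_ htgt (hexists ?_)
      · intro u hu hl
        refine charVec_eq_of_average ha hedge hfst m1 ?_ ?_ hu hl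
        · rw [m2, ← e1]; ring
        · rw [m3, e2]; ring
      · rw [m1]
        exact ha.iterate_sigma_fst_pos _

end MarkovChain

/-! ### Completeness: the model of a computation -/

theorem integral_map_ofFintype {S ι : Type*} [Fintype ι] [MeasurableSpace S]
    [DiscreteMeasurableSpace S] {w : ι → ℝ} (hw : ∀ i, 0 ≤ w i)
    (hsum : ∑ i, ENNReal.ofReal (w i) = 1) (g : ι → S) (f : S → ℝ) :
    ∫ u, f u ∂((PMF.ofFintype (fun i => ENNReal.ofReal (w i)) hsum).map g).toMeasure =
      ∑ i, w i * f (g i) := by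
  let : MeasurableSpace ι := ⊤
  have : DiscreteMeasurableSpace ι := ⟨fun _ => trivial⟩
  rw [← PMF.toMeasure_map g _ .of_discrete, integral_map_of_stronglyMeasurable .of_discrete
    Measurable.of_discrete.stronglyMeasurable, PMF.integral_eq_sum]
  refine Finset.sum_congr rfl fun i _ => ?_
  rw [PMF.ofFintype_apply, ENNReal.toReal_ofReal (hw i), smul_eq_mul]

/-- The Markov chain in which each state `s` has seven possible moves: the `i`-th one has
probability `w s i` and leads to `target s i`. -/
def MarkovChain.ofWeights {S : Type} (hS : Countable S) (w : S → Fin 7 → ℝ)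
    (hw : ∀ s i, 0 ≤ w s i) (hsum : ∀ s, ∑ i, w s i = 1) (target : S → Fin 7 → S)
    (val : S → Set AP) : MarkovChain where
  S := S
  countable := hS
  step s := (PMF.ofFintype (fun i => ENNReal.ofReal (w s i)) (by
    rw [← ENNReal.ofReal_sum_of_nonneg fun i _ => hw s i, hsum, ENNReal.ofReal_one])).map (target s)
  val := val

namespace MarkovChain

theorem ave_ofWeights {S : Type} {hS : Countable S} {w : S → Fin 7 → ℝ}
    {hw : ∀ s i, 0 ≤ w s i} {hsum : ∀ s, ∑ i, w s i = 1} {target : S → Fin 7 → S}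
    {val : S → Set AP} (s : (ofWeights hS w hw hsum target val).S)
    (f : (ofWeights hS w hw hsum target val).S → ℝ) :
    (ofWeights hS w hw hsum target val).ave s f = ∑ i, w s i * f (target s i) := by
  let : MeasurableSpace S := ⊤
  have : DiscreteMeasurableSpace S := ⟨fun _ => trivial⟩
  exact integral_map_ofFintype (hw s) _ (target s) f

theorem succ_ofWeights {S : Type} {hS : Countable S} {w : S → Fin 7 → ℝ}
    {hw : ∀ s i, 0 ≤ w s i} {hsum : ∀ s, ∑ i, w s i = 1} {target : S → Fin 7 → S}
    {val : S → Set AP} {s u : (ofWeights hS w hw hsum target val).S} :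
    (ofWeights hS w hw hsum target val).Succ s u ↔ ∃ i, 0 < w s i ∧ target s i = u := by
  unfold Succ
  rw [PMF.apply_pos_iff]
  change u ∈ (PMF.map (target s) _).support ↔ _
  refine (PMF.mem_support_map_iff (target s) _ u).trans ?_
  refine exists_congr fun i => and_congr_left fun _ => ?_
  rw [PMF.mem_support_ofFintype_iff, ne_eq, ENNReal.ofReal_eq_zero, not_le]

end MarkovChain

/-- The data from which the model of a computation is built: points `T` of a computation, with their
configurations, parities and next points; and indices `N` of counter values, closed under
truncated decrements. For a periodic computation, both can be chosen finite. -/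
structure Unfolding (P : Program) where
  T : Type
  N : Type
  countable_T : Countable T
  countable_N : Countable N
  config : T → Config
  parity : T → Bool
  next : T → T
  parity_next : ∀ t, parity (next t) = !parity t
  step_next : ∀ t, Program.Step P (config t) (config (next t))
  value : N → ℕ
  prev : N → N
  value_prev : ∀ n, value (prev n) = value n - 1
  start : T → N
  value_start : ∀ t, value (start t) = (config t).2

/-- The states of the model: labelled states for the points of the computation, verification states
for counter values, the four kinds of leaves for the propositions `a`, `b`, `cF` and `dF`, a goal
state, and a sink. -/
inductive ModelState (T N : Type) : Type
  | lab (t : T) : ModelState T N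
  | ver (n : N) (b : Bool) : ModelState T N
  | leaf (k : Fin 4) (b : Bool) : ModelState T N
  | goal : ModelState T N
  | sink : ModelState T N

namespace ModelState

variable {T N : Type}

/-- An embedding of the states into a sum of products. -/
def toSum : ModelState T N → T ⊕ (N × Bool) ⊕ (Fin 4 × Bool) ⊕ Bool
  | lab t => .inl t
  | ver n b => .inr (.inl (n, b))
  | leaf k b => .inr (.inr (.inl (k, b)))
  | goal => .inr (.inr (.inr true))
  | sink => .inr (.inr (.inr false))

theorem toSum_injective : Function.Injective (toSum : ModelState T N → _) := by
  intro s s' h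
  cases s <;> cases s' <;> simp_all [toSum]

instance [Countable T] [Countable N] : Countable (ModelState T N) := toSum_injective.countable

instance [Finite T] [Finite N] : Finite (ModelState T N) := Finite.of_injective _ toSum_injective

end ModelState

namespace Unfolding

open ModelState

variable {P : Program} (U : Unfolding P) (q : ℝ) (κ : ℝ × ℝ)

/-- The probabilities of the moves of a counter state with counter value `n`: to the four kinds of
leaves, to a verification state with probability `v`, to a labelled state with probability `l`,
and to the sink. -/
def counterWeight (n : ℕ) (v l : ℝ) : Fin 7 → ℝ :=
  ![((sigma q)^[n] κ).1, ((sigma q)^[n] κ).2, κ.1 - ((sigma q)^[n] κ).1,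
    κ.2 - ((sigma q)^[n] κ).2, v, l, 1 - (κ.1 + κ.2 + v + l)]

/-- The probability of moving from a labelled state to a verification state. -/
def verWeight (x : ℝ) : Instr → ℝ
  | .inc _ => x
  | .testDec _ _ => 0

/-- The probability of moving from a labelled state to a labelled state. -/
def labWeight (x : ℝ) : Instr → ℝ
  | .inc _ => (1 - q) * (1 - x)
  | .testDec _ _ => x

/-- The probability of moving from a leaf to the goal state. -/
def leafWeight : Fin 4 → ℝ :=
  ![1 - q, disc q κ.1, κ.2 * (q - κ.1), (1 - q) * (1 - q)]

/-- The instruction at a point of the computation. -/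
def instr (t : U.T) : Instr := instrAt P ((U.config t).1 - 1)

/-- The transition probabilities of the model. A leaf enters the goal state through the move with
the number `5`; the moves of probability `0` have arbitrary targets. -/
def weight : ModelState U.T U.N → Fin 7 → ℝ
  | lab t => counterWeight q κ (U.config t).2
      (verWeight ((sigma q)^[(U.config t).2] κ).1 (U.instr t))
      (labWeight q ((sigma q)^[(U.config t).2] κ).1 (U.instr t))
  | ver n _ => counterWeight q κ (U.value n) ((sigma q)^[U.value n] κ).1 0
  | leaf k _ => ![0, 0, 0, 0, 0, leafWeight q κ k, 1 - leafWeight q κ k]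
  | goal => ![0, 0, 0, 0, 0, 0, 1]
  | sink => ![0, 0, 0, 0, 0, 0, 1]

/-- The targets of the moves of the model. Leaves inherit the parity of their predecessor, and
counter states have the opposite parity. -/
def target : ModelState U.T U.N → Fin 7 → ModelState U.T U.N
  | lab t => ![leaf 0 (U.parity t), leaf 1 (U.parity t), leaf 2 (U.parity t), leaf 3 (U.parity t),
      ver (U.prev (U.start t)) (!U.parity t), lab (U.next t), sink]
  | ver n b => ![leaf 0 b, leaf 1 b, leaf 2 b, leaf 3 b, ver (U.prev n) (!b), sink, sink]
  | leaf _ _ => ![sink, sink, sink, sink, sink, goal, sink]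
  | goal => fun _ => sink
  | sink => fun _ => sink

/-- The propositions valid in a state of the model. -/
def valuation : ModelState U.T U.N → Set AP
  | lab t => {p | p = .label (U.config t).1 ∨ (p = .other 0 ∧ U.parity t = true)}
  | ver _ b => {p | p = .other 4 ∨ (p = .other 0 ∧ b = true)}
  | leaf k b => {p | p = ![.a, .b, .other 1, .other 2] k ∨ (p = .other 0 ∧ b = true)}
  | goal => {.other 3}
  | sink => ∅

variable {q κ}

theorem weight_nonneg (ha : Admissible q κ) (s : ModelState U.T U.N) (i : Fin 7) :
    0 ≤ U.weight q κ s i := by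
  obtain ⟨h1, h2, h3, h4, h5, h6, -⟩ := ha.bounds
  have key : ∀ (n : ℕ) (v l : ℝ), 0 ≤ v → 0 ≤ l → v + l ≤ κ.1 + (1 - q) →
      0 ≤ counterWeight q κ n v l i := by
    intro n v l hv hl hvl
    have b1 := ha.iterate_sigma_fst_pos n
    have b2 := ha.iterate_sigma_fst_le n
    have b3 := ha.iterate_sigma_snd_pos n
    have b4 := ha.iterate_sigma_snd_le n
    have b5 := ha.sum_lt
    have b6 := ha.snd_pos
    -- for the last move, `κ₁ + κ₂ + v + l ≤ 2 (κ₁ + κ₂) + (1 - q) < q`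
    fin_cases i <;> simp [counterWeight] <;> linarith
  cases s with
  | lab t =>
    have b1 := ha.iterate_sigma_fst_pos (U.config t).2
    have b2 := ha.iterate_sigma_fst_le (U.config t).2
    have b3 := ha.one_sub_iterate_sigma_pos (U.config t).2
    have b4 : (1 - q) * (1 - ((sigma q)^[(U.config t).2] κ).1) ≤ 1 - q :=
      mul_le_of_le_one_right h1 (by linarith)
    refine key _ _ _ ?_ ?_ ?_ <;> cases U.instr t <;> simp only [verWeight, labWeight]
    · exact b1.le
    · exact le_rfl
    · exact mul_nonneg h1 b3.le
    · exact b1.le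
    · linarith
    · linarith
  | ver n b =>
    have b1 := ha.iterate_sigma_fst_pos (U.value n)
    have b2 := ha.iterate_sigma_fst_le (U.value n)
    exact key _ _ _ b1.le le_rfl (by linarith)
  | leaf k b =>
    have h7 : 0 ≤ leafWeight q κ k ∧ leafWeight q κ k ≤ 1 := by
      have h8 := mul_nonneg h1 h1
      have h9 := mul_le_one₀ h2 h1 h2
      fin_cases k
      · exact ⟨h1, h2⟩
      · exact ⟨h3, h4⟩
      · exact ⟨h5, h6⟩
      · exact ⟨h8, h9⟩
    fin_cases i <;> simp [weight, h7.1, h7.2]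
  | goal => fin_cases i <;> simp [weight]
  | sink => fin_cases i <;> simp [weight]

theorem sum_weight (s : ModelState U.T U.N) : ∑ i, U.weight q κ s i = 1 := by
  cases s <;> simp only [weight, counterWeight, Fin.sum_univ_seven] <;> simp <;> ring

variable (ha : Admissible q κ)

/-- The model of a computation. -/
def chain : MarkovChain :=
  MarkovChain.ofWeights (S := ModelState U.T U.N)
    (by have := U.countable_T; have := U.countable_N; infer_instance)
    (U.weight q κ) (U.weight_nonneg ha) U.sum_weight U.target U.valuation

/-- A state of the model, as a state of the Markov chain. -/
def state (s : ModelState U.T U.N) : (U.chain ha).S := s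

variable {ha}

theorem ave_chain (s : ModelState U.T U.N) (f : (U.chain ha).S → ℝ) :
    (U.chain ha).ave (U.state ha s) f =
      ∑ i, U.weight q κ s i * f (U.state ha (U.target s i)) :=
  MarkovChain.ave_ofWeights _ _

theorem succ_chain {s u : ModelState U.T U.N} :
    (U.chain ha).Succ (U.state ha s) (U.state ha u) ↔
      ∃ i, 0 < U.weight q κ s i ∧ U.target s i = u :=
  MarkovChain.succ_ofWeights

theorem sat_atom_state {s : ModelState U.T U.N} {p : AP} :
    (U.chain ha).Sat (U.state ha s) (.atom p) ↔ p ∈ U.valuation s := Iff.rfl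

/-- The states among which the successors of a state are found. -/
theorem eq_target_of_succ {s : ModelState U.T U.N} {u : (U.chain ha).S}
    (h : (U.chain ha).Succ (U.state ha s) u) : ∃ i, u = U.state ha (U.target s i) := by
  obtain ⟨i, -, hi⟩ := U.succ_chain.1 h
  exact ⟨i, hi.symm⟩

theorem config_mem_labels (t : U.T) : (U.config t).1 ∈ Program.labels P := by
  obtain ⟨ins, h1, h2, -⟩ := U.step_next t
  have := (List.getElem?_eq_some_iff.1 h2).1
  exact ⟨h1, by omega⟩

theorem performs_instr (t : U.T) : (U.instr t).Performs (U.config t).2 (U.config (U.next t)) := by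
  obtain ⟨ins, h1, h2, h3⟩ := U.step_next t
  have : U.instr t = ins := by
    rw [instr, instrAt, List.getD_eq_getElem?_getD, h2, Option.getD_some]
  rwa [this]

section Sat

variable {s : ModelState U.T U.N}

theorem sat_aF : (U.chain ha).Sat (U.state ha s) aF ↔ ∃ b, s = leaf 0 b := by
  rw [aF, sat_atom_state]
  cases s with
  | leaf k b => fin_cases k <;> simp [valuation]
  | _ => simp [valuation]

theorem sat_bF : (U.chain ha).Sat (U.state ha s) bF ↔ ∃ b, s = leaf 1 b := by
  rw [bF, sat_atom_state]
  cases s with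
  | leaf k b => fin_cases k <;> simp [valuation]
  | _ => simp [valuation]

theorem sat_cF : (U.chain ha).Sat (U.state ha s) cF ↔ ∃ b, s = leaf 2 b := by
  rw [cF, sat_atom_state]
  cases s with
  | leaf k b => fin_cases k <;> simp [valuation]
  | _ => simp [valuation]

theorem sat_dF : (U.chain ha).Sat (U.state ha s) dF ↔ ∃ b, s = leaf 3 b := by
  rw [dF, sat_atom_state]
  cases s with
  | leaf k b => fin_cases k <;> simp [valuation]
  | _ => simp [valuation]

theorem sat_leafF : (U.chain ha).Sat (U.state ha s) leafF ↔ ∃ k b, s = leaf k b := by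
  rw [MarkovChain.sat_leafF, sat_aF, sat_bF, sat_cF, sat_dF]
  cases s with
  | leaf k b => fin_cases k <;> simp
  | _ => simp

theorem sat_goalF : (U.chain ha).Sat (U.state ha s) goalF ↔ s = goal := by
  rw [goalF, sat_atom_state]
  cases s with
  | leaf k b => fin_cases k <;> simp [valuation]
  | _ => simp [valuation]

theorem sat_verF : (U.chain ha).Sat (U.state ha s) verF ↔ ∃ n b, s = ver n b := by
  rw [verF, sat_atom_state]
  cases s with
  | leaf k b => fin_cases k <;> simp [valuation]
  | _ => simp [valuation]

theorem sat_label {i : ℕ} :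
    (U.chain ha).Sat (U.state ha s) (.atom (.label i)) ↔ ∃ t, s = lab t ∧ (U.config t).1 = i := by
  rw [sat_atom_state]
  cases s with
  | leaf k b => fin_cases k <;> simp [valuation]
  | lab t => simpa [valuation] using eq_comm
  | _ => simp [valuation]

theorem sat_labF : (U.chain ha).Sat (U.state ha s) (labF P) ↔ ∃ t, s = lab t := by
  rw [MarkovChain.sat_labF]
  constructor
  · rintro ⟨i, -, hi⟩
    obtain ⟨t, ht, -⟩ := U.sat_label.1 hi
    exact ⟨t, ht⟩
  · rintro ⟨t, rfl⟩
    exact ⟨_, U.config_mem_labels t, U.sat_label.2 ⟨t, rfl, rfl⟩⟩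

theorem sat_counterF : (U.chain ha).Sat (U.state ha s) (counterF P) ↔
    (∃ t, s = lab t) ∨ ∃ n b, s = ver n b := by
  rw [MarkovChain.sat_counterF, sat_labF, sat_verF]

theorem sat_parityF_lab {t : U.T} {b : Bool} :
    (U.chain ha).Sat (U.state ha (lab t)) (parityF b) ↔ b = U.parity t := by
  cases b <;> simp [parityF, MarkovChain.sat_neg, sat_atom_state, valuation]

theorem sat_parityF_ver {n : U.N} {b b' : Bool} :
    (U.chain ha).Sat (U.state ha (ver n b')) (parityF b) ↔ b = b' := by
  cases b <;> simp [parityF, MarkovChain.sat_neg, sat_atom_state, valuation]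

theorem sat_parityF_leaf {k : Fin 4} {b b' : Bool} :
    (U.chain ha).Sat (U.state ha (leaf k b')) (parityF b) ↔ b = b' := by
  fin_cases k <;> cases b <;>
    simp [parityF, MarkovChain.sat_neg, sat_atom_state, valuation]

end Sat

end Unfolding

theorem MarkovChain.mem_sat {M : MarkovChain} {t : M.S} {φ : Formula} :
    t ∈ M.sat φ ↔ M.Sat t φ := Iff.rfl

namespace Unfolding

open ModelState

variable {P : Program} (U : Unfolding P)

section Averages

variable {q : ℝ} {κ : ℝ × ℝ} {ha : Admissible q κ}

theorem ave_indicator_chain (s : ModelState U.T U.N) (φ : Formula) (f : (U.chain ha).S → ℝ) :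
    (U.chain ha).ave (U.state ha s) (((U.chain ha).sat φ).indicator f) =
      ∑ i, U.weight q κ s i *
        (((U.chain ha).sat φ).indicator f (U.state ha (U.target s i))) :=
  U.ave_chain _ _

theorem stepProb_chain (s : ModelState U.T U.N) (φ : Formula) :
    (U.chain ha).stepProb (U.state ha s) ((U.chain ha).sat φ) =
      ∑ i, U.weight q κ s i *
        (((U.chain ha).sat φ).indicator 1 (U.state ha (U.target s i))) := by
  rw [MarkovChain.stepProb_eq_ave, ave_indicator_chain]

theorem stepProb_leaf_goal (k : Fin 4) (b : Bool) :
    (U.chain ha).stepProb (U.state ha (leaf k b)) ((U.chain ha).sat goalF) =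
      leafWeight q κ k := by
  rw [stepProb_chain, Fin.sum_univ_seven]
  simp [weight, target, MarkovChain.mem_sat, sat_goalF]

theorem charVec_lab (t : U.T) :
    (U.chain ha).charVec (U.state ha (lab t)) = (sigma q)^[(U.config t).2] κ := by
  refine Prod.ext ?_ ?_
  · rw [MarkovChain.charVec_fst, stepProb_chain, Fin.sum_univ_seven]
    simp [weight, counterWeight, target, MarkovChain.mem_sat, sat_aF]
  · rw [MarkovChain.charVec_snd, stepProb_chain, Fin.sum_univ_seven]
    simp [weight, counterWeight, target, MarkovChain.mem_sat, sat_bF]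

theorem charVec_ver (n : U.N) (b : Bool) :
    (U.chain ha).charVec (U.state ha (ver n b)) = (sigma q)^[U.value n] κ := by
  refine Prod.ext ?_ ?_
  · rw [MarkovChain.charVec_fst, stepProb_chain, Fin.sum_univ_seven]
    simp [weight, counterWeight, target, MarkovChain.mem_sat, sat_aF]
  · rw [MarkovChain.charVec_snd, stepProb_chain, Fin.sum_univ_seven]
    simp [weight, counterWeight, target, MarkovChain.mem_sat, sat_bF]

theorem ave_lab_labF (t : U.T) (f : (U.chain ha).S → ℝ) :
    (U.chain ha).ave (U.state ha (lab t)) (((U.chain ha).sat (labF P)).indicator f) =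
      labWeight q ((sigma q)^[(U.config t).2] κ).1 (U.instr t) *
        f (U.state ha (lab (U.next t))) := by
  rw [ave_indicator_chain, Fin.sum_univ_seven]
  simp [weight, counterWeight, target, MarkovChain.mem_sat, sat_labF]

theorem ave_lab_verF (t : U.T) (f : (U.chain ha).S → ℝ) :
    (U.chain ha).ave (U.state ha (lab t)) (((U.chain ha).sat verF).indicator f) =
      verWeight ((sigma q)^[(U.config t).2] κ).1 (U.instr t) *
        f (U.state ha (ver (U.prev (U.start t)) (!U.parity t))) := by
  rw [ave_indicator_chain, Fin.sum_univ_seven]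
  simp [weight, counterWeight, target, MarkovChain.mem_sat, sat_verF]

theorem ave_ver_verF (n : U.N) (b : Bool) (f : (U.chain ha).S → ℝ) :
    (U.chain ha).ave (U.state ha (ver n b)) (((U.chain ha).sat verF).indicator f) =
      ((sigma q)^[U.value n] κ).1 * f (U.state ha (ver (U.prev n) (!b))) := by
  rw [ave_indicator_chain, Fin.sum_univ_seven]
  simp [weight, counterWeight, target, MarkovChain.mem_sat, sat_verF]

/-- If all `χ`-successors of a state with counter value `n + 1` have counter value `n` and their
total weight is the first coordinate of the vector of the state, then they average to the preimage
of that vector. -/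
theorem decAverage_of_ave {M : MarkovChain} {t : M.S} (ha : Admissible q κ) {χ : Formula} {n : ℕ}
    (ht : M.charVec t = (sigma q)^[n + 1] κ) {v : M.S} (hv : M.charVec v = (sigma q)^[n] κ)
    (h : ∀ f : M.S → ℝ, M.ave t ((M.sat χ).indicator f) = ((sigma q)^[n + 1] κ).1 * f v) :
    M.stepProb t (M.sat χ) = (M.charVec t).1 ∧
    M.ave t ((M.sat χ).indicator fun u => (M.charVec u).1) = (M.charVec t).1 - (1 - q) ∧
    M.ave t ((M.sat χ).indicator fun u => (M.charVec u).2) = (M.charVec t).2 := by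
  have e1 := ha.iterate_sigma_succ_fst n
  have e2 := Admissible.iterate_sigma_succ_snd (q := q) (κ := κ) n
  rw [MarkovChain.stepProb_eq_ave, h, h, h, hv, ht]
  refine ⟨by simp, by rw [← e1]; ring, by rw [e2]; ring⟩

end Averages

variable {q : ℚ} {κ : ℚ × ℚ} {ha : Admissible q (realVec κ)}

theorem basic_state (s : ModelState U.T U.N) :
    (U.chain ha).Basic P q κ (U.state ha s) where
  not_a_c h := by
    obtain ⟨b, rfl⟩ := U.sat_aF.1 h
    simp [sat_cF]
  not_b_d h := by
    obtain ⟨b, rfl⟩ := U.sat_bF.1 h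
    simp [sat_dF]
  not_b_c h := by
    obtain ⟨b, rfl⟩ := U.sat_bF.1 h
    simp [sat_cF]
  counter_not_leaf h := by
    rcases U.sat_counterF.1 h with ⟨t, rfl⟩ | ⟨n, b, rfl⟩ <;> simp [sat_leafF]
  counter_not_goal h := by
    rcases U.sat_counterF.1 h with ⟨t, rfl⟩ | ⟨n, b, rfl⟩ <;> simp [sat_goalF]
  leaf_succ h v hv := by
    obtain ⟨k, b, rfl⟩ := U.sat_leafF.1 h
    obtain ⟨i, rfl⟩ := U.eq_target_of_succ hv
    fin_cases i <;> simp [target, sat_leafF, sat_counterF]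
  a_goal h := by
    obtain ⟨b, rfl⟩ := U.sat_aF.1 h
    exact U.stepProb_leaf_goal 0 b
  b_goal h := by
    obtain ⟨b, rfl⟩ := U.sat_bF.1 h
    exact U.stepProb_leaf_goal 1 b
  c_goal h := by
    obtain ⟨b, rfl⟩ := U.sat_cF.1 h
    exact U.stepProb_leaf_goal 2 b
  d_goal h := by
    obtain ⟨b, rfl⟩ := U.sat_dF.1 h
    exact U.stepProb_leaf_goal 3 b
  succ_not_goal h v hv := by
    rcases U.sat_counterF.1 h with ⟨t, rfl⟩ | ⟨n, b, rfl⟩ <;>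
      obtain ⟨i, rfl⟩ := U.eq_target_of_succ hv <;> fin_cases i <;> simp [target, sat_goalF]
  succ_leaf h b hb v hv := by
    rcases U.sat_counterF.1 h with ⟨t, rfl⟩ | ⟨n, b, rfl⟩ <;>
      obtain ⟨i, rfl⟩ := U.eq_target_of_succ hv
    · obtain rfl := U.sat_parityF_lab.1 hb
      fin_cases i <;> simp [target, sat_leafF, sat_parityF_leaf]
    · obtain rfl := U.sat_parityF_ver.1 hb
      fin_cases i <;> simp [target, sat_leafF, sat_parityF_leaf]
  succ_counter h b hb v hv := by
    rcases U.sat_counterF.1 h with ⟨t, rfl⟩ | ⟨n, b, rfl⟩ <;>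
      obtain ⟨i, rfl⟩ := U.eq_target_of_succ hv
    · obtain rfl := U.sat_parityF_lab.1 hb
      fin_cases i <;>
        simp [target, sat_counterF, sat_parityF_ver, sat_parityF_lab, U.parity_next]
    · obtain rfl := U.sat_parityF_ver.1 hb
      fin_cases i <;> simp [target, sat_counterF, sat_parityF_ver]

theorem not_labF_of_reachable {s : ModelState U.T U.N} (hs : ∀ t, s ≠ lab t) {u : (U.chain ha).S}
    (hu : (U.chain ha).Reachable (U.state ha s) u) :
    ∃ s' : ModelState U.T U.N, u = U.state ha s' ∧ ∀ t, s' ≠ lab t := by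
  induction hu with
  | refl => exact ⟨s, rfl, hs⟩
  | tail _ hv ih =>
    obtain ⟨s', hss', hs'⟩ := ih
    rw [hss'] at hv
    obtain ⟨i, rfl⟩ := U.eq_target_of_succ hv
    refine ⟨_, rfl, ?_⟩
    cases s' with
    | lab t => exact absurd rfl (hs' t)
    | goal => simp [target]
    | sink => simp [target]
    | _ => fin_cases i <;> simp [target]

theorem sat_alwaysAS_noLabel {s : ModelState U.T U.N} (hs : ∀ t, s ≠ lab t) :
    (U.chain ha).Sat (U.state ha s) (noLabel P).alwaysAS := by
  refine MarkovChain.sat_alwaysAS.2 fun u hu => ?_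
  obtain ⟨s', rfl, hs'⟩ := U.not_labF_of_reachable hs hu
  by_contra hc
  obtain ⟨t, ht⟩ := U.sat_labF.1 hc
  exact hs' t ht

theorem sat_onlyLabelF (t : U.T) :
    (U.chain ha).Sat (U.state ha (lab t)) (onlyLabelF P (U.config t).1) := by
  rw [MarkovChain.sat_onlyLabelF]
  refine ⟨U.sat_label.2 ⟨t, rfl, rfl⟩, fun j _ hj h => ?_⟩
  obtain ⟨t', h1, h2⟩ := U.sat_label.1 h
  obtain rfl := ModelState.lab.inj h1
  exact hj h2.symm

theorem sat_targetF {t : U.T} {L : Target} (h : (U.config t).1 ∈ L.labels) :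
    (U.chain ha).Sat (U.state ha (lab t)) (targetF P L) := by
  rw [targetF, MarkovChain.sat_disj]
  have := U.sat_onlyLabelF (ha := ha) t
  rcases h with h | h
  · left; rwa [← h]
  · right; rwa [← Set.mem_singleton_iff.1 h]

/-- The successors of a labelled state are the state at the next point of the computation and
states that never reach a label. -/
theorem succ_lab_cases {t : U.T} {u : (U.chain ha).S}
    (hu : (U.chain ha).Succ (U.state ha (lab t)) u) :
    u = U.state ha (lab (U.next t)) ∨ (U.chain ha).Sat u (noLabel P).alwaysAS := by
  obtain ⟨i, rfl⟩ := U.eq_target_of_succ hu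
  by_cases h : ∀ t', U.target (lab t) i ≠ lab t'
  · exact Or.inr (U.sat_alwaysAS_noLabel h)
  · push Not at h
    obtain ⟨t', h⟩ := h
    left
    rw [h]
    congr 2
    revert h
    fin_cases i <;> simp [target, eq_comm]

theorem decAverage_ver {n : U.N} {b : Bool} (hn : U.value n ≠ 0) :
    (U.chain ha).DecAverage (U.state ha (ver n b)) q verF := by
  obtain ⟨m, hm⟩ := Nat.exists_eq_succ_of_ne_zero hn
  have h := decAverage_of_ave (M := U.chain ha) ha (n := m) (χ := verF)
    (t := U.state ha (ver n b)) (v := U.state ha (ver (U.prev n) (!b)))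
    (by rw [charVec_ver, hm]) (by rw [charVec_ver, U.value_prev, hm]; rfl)
    (fun f => by rw [ave_ver_verF, hm])
  exact ⟨h.1, h.2.1, h.2.2⟩

theorem instrMeaning_lab (t : U.T) :
    (U.chain ha).InstrMeaning (U.state ha (lab t)) P q κ (U.instr t) := by
  have hp := U.performs_instr t
  cases hins : U.instr t with
  | inc L =>
    rw [hins] at hp
    obtain ⟨h1, h2⟩ := hp
    refine ⟨?_, ?_, ?_⟩
    · have e1 := ha.iterate_sigma_succ_fst (U.config t).2
      have e2 := Admissible.iterate_sigma_succ_snd (q := (q : ℝ)) (κ := realVec κ) (U.config t).2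
      refine ⟨?_, ?_, ?_⟩
      · rw [MarkovChain.stepProb_eq_ave, ave_lab_labF, hins, labWeight, charVec_lab]; simp
      · rw [ave_lab_labF, hins, labWeight, charVec_lab, h2]
        linear_combination (1 - (q : ℝ)) * e1
      · rw [ave_lab_labF, hins, labWeight, charVec_lab, charVec_lab, h2, e2]
        linear_combination (1 - (q : ℝ)) * ((sigma q)^[(U.config t).2] (realVec κ)).2 * e1
    · by_cases h0 : (U.config t).2 = 0
      · left; rw [charVec_lab, h0]; rfl
      · right
        obtain ⟨m, hm⟩ := Nat.exists_eq_succ_of_ne_zero h0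
        have h := decAverage_of_ave (M := U.chain ha) ha (n := m) (χ := verF)
          (t := U.state ha (lab t)) (v := U.state ha (ver (U.prev (U.start t)) (!U.parity t)))
          (by rw [charVec_lab, hm])
          (by rw [charVec_ver, U.value_prev, U.value_start, hm]; rfl)
          (fun f => by rw [ave_lab_verF, hins, hm, verWeight])
        exact ⟨h.1, h.2.1, h.2.2⟩
    · intro u hu
      refine (U.succ_lab_cases hu).imp_left ?_
      rintro rfl
      exact U.sat_targetF h1
  | testDec L L' =>
    rw [hins] at hp
    rcases hp with ⟨h1, h2, h3⟩ | ⟨h1, h2, h3⟩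
    · have hz : (U.chain ha).charVec (U.state ha (lab (U.next t))) = realVec κ := by
        rw [charVec_lab, h3]; rfl
      refine Or.inl ⟨by rw [charVec_lab, h1]; rfl, ⟨U.state ha (lab (U.next t)), ?_, ?_⟩, ?_⟩
      · refine U.succ_chain.2 ⟨5, ?_, rfl⟩
        simp only [weight, counterWeight, hins, labWeight]
        exact ha.iterate_sigma_fst_pos _
      · exact U.sat_labF.2 ⟨_, rfl⟩
      · intro u hu
        refine (U.succ_lab_cases hu).imp_left ?_
        rintro rfl
        exact ⟨U.sat_targetF h2, hz⟩
    · refine Or.inr ⟨?_, ?_, ?_⟩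
      · rwa [charVec_lab, ne_eq, ha.iterate_sigma_eq_self_iff]
      · have h := decAverage_of_ave (M := U.chain ha) ha (n := (U.config (U.next t)).2)
          (χ := labF P) (t := U.state ha (lab t)) (v := U.state ha (lab (U.next t)))
          (by rw [charVec_lab, h3]) (by rw [charVec_lab])
          (fun f => by rw [ave_lab_labF, hins, h3, labWeight])
        exact ⟨h.1, h.2.1, h.2.2⟩
      · intro u hu
        refine (U.succ_lab_cases hu).imp_left ?_
        rintro rfl
        exact U.sat_targetF h2

theorem invariant_state (s : ModelState U.T U.N) :
    (U.chain ha).Invariant (U.state ha s) P q κ where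
  basic := U.basic_state s
  vector h := by
    rcases U.sat_counterF.1 h with ⟨t, rfl⟩ | ⟨n, b, rfl⟩
    · rw [charVec_lab]
      refine ⟨?_, ?_, ha.edge_zero_iterate_nonneg _⟩ <;>
        rw [stepProb_chain, Fin.sum_univ_seven] <;>
        simp [weight, counterWeight, target, MarkovChain.mem_sat, sat_cF,
          sat_dF]
    · rw [charVec_ver]
      refine ⟨?_, ?_, ha.edge_zero_iterate_nonneg _⟩ <;>
        rw [stepProb_chain, Fin.sum_univ_seven] <;>
        simp [weight, counterWeight, target, MarkovChain.mem_sat, sat_cF,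
          sat_dF]
  verify h := by
    obtain ⟨n, b, rfl⟩ := U.sat_verF.1 h
    by_cases hn : U.value n = 0
    · left; rw [charVec_ver, hn]; rfl
    · exact Or.inr (U.decAverage_ver hn)
  instr i _ h := by
    obtain ⟨t, rfl, ht⟩ := U.sat_label.1 h
    have := U.instrMeaning_lab (ha := ha) t
    rwa [instr, ht, Nat.add_sub_cancel] at this

theorem sat_machineF {t : U.T} (ht : U.config t = (1, 0)) :
    (U.chain ha).Sat (U.state ha (lab t)) (machineF q κ P) := by
  refine (MarkovChain.sat_machineF ha).2 ⟨?_, ?_, fun u _ => U.invariant_state u⟩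
  · have := U.sat_onlyLabelF (ha := ha) t
    rwa [ht] at this
  · rw [charVec_lab, ht]; rfl

theorem represents_lab (t : U.T) :
    (U.chain ha).Represents q (realVec κ) P (U.state ha (lab t)) (U.config t) :=
  ⟨U.config_mem_labels t, (MarkovChain.sat_onlyLabelF.1 (U.sat_onlyLabelF t)).1,
    (MarkovChain.sat_onlyLabelF.1 (U.sat_onlyLabelF t)).2, U.charVec_lab t⟩

theorem succ_next (t : U.T) :
    (U.chain ha).Succ (U.state ha (lab t)) (U.state ha (lab (U.next t))) := by
  refine U.succ_chain.2 ⟨5, ?_, rfl⟩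
  simp only [weight, counterWeight]
  cases hins : U.instr t with
  | inc L => exact mul_pos (by linarith [ha.q_lt]) (ha.one_sub_iterate_sigma_pos _)
  | testDec L L' => exact ha.iterate_sigma_fst_pos _

end Unfolding

/-! ### The unfolding of a computation -/

section Computation

variable {P : Program} {ω : ℕ → Config}

/-- The point of the computation at time `k`: the suffix of the computation from there on, and the
parity of `k`. A periodic computation has only finitely many points. -/
def point (ω : ℕ → Config) (k : ℕ) : (ℕ → Config) × Bool := (fun i => ω (k + i), k.bodd)

/-- The unfolding of a computation. -/
def computationUnfolding (h : P.IsComputation ω) : Unfolding P where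
  T := Set.range (point ω)
  N := {n : ℕ // ∃ k, n ≤ (ω k).2}
  countable_T := (Set.countable_range _).to_subtype
  countable_N := inferInstance
  config t := t.1.1 0
  parity t := t.1.2
  next t := ⟨(fun i => t.1.1 (i + 1), !t.1.2), by
    obtain ⟨k, hk⟩ := t.2
    refine ⟨k + 1, ?_⟩
    rw [← hk]
    simp only [point, Nat.bodd_succ, Prod.mk.injEq, and_true]
    funext i
    congr 1
    omega⟩
  parity_next _ := rfl
  step_next t := by
    obtain ⟨k, hk⟩ := t.2
    simp only [← hk]
    exact h.2 k
  value n := n.1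
  prev n := ⟨n.1 - 1, n.2.imp fun k hk => (Nat.sub_le _ _).trans hk⟩
  value_prev _ := rfl
  start t := ⟨(t.1.1 0).2, by
    obtain ⟨k, hk⟩ := t.2
    exact ⟨k, by rw [← hk]; exact le_rfl⟩⟩
  value_start _ := rfl

theorem finite_range_point (h : Periodic ω) : (Set.range (point ω)).Finite := by
  obtain ⟨i, j, hij, hp⟩ := h
  -- twice the period preserves the parity
  have hp2 : ∀ k, i ≤ k → point ω (k + 2 * (j - i)) = point ω k := by
    intro k hk
    obtain ⟨l, rfl⟩ := Nat.exists_eq_add_of_le hk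
    refine Prod.ext ?_ ?_
    · funext m
      simp only [point]
      have h1 := hp (l + (j - i) + m)
      have h2 := hp (l + m)
      rw [show i + l + 2 * (j - i) + m = j + (l + (j - i) + m) by omega, ← h1,
        show i + (l + (j - i) + m) = j + (l + m) by omega, ← h2, add_assoc]
    · simp [point, Nat.bodd_add, Nat.bodd_mul]
  have hsub : Set.range (point ω) ⊆ point ω '' (Set.Iio (i + 2 * (j - i))) := by
    rintro _ ⟨k, rfl⟩
    induction k using Nat.strong_induction_on with
    | _ k ih =>
      by_cases hk : k < i + 2 * (j - i)
      · exact ⟨k, hk, rfl⟩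
      · push Not at hk
        have := hp2 (k - 2 * (j - i)) (by omega)
        rw [Nat.sub_add_cancel (by omega)] at this
        rw [this]
        exact ih _ (by omega)
  exact ((Set.finite_Iio _).image _).subset hsub

theorem finite_values (h : Periodic ω) : Finite {n : ℕ // ∃ k, n ≤ (ω k).2} := by
  have h1 : {n : ℕ | ∃ k, n ≤ (ω k).2} =
      ⋃ p ∈ Set.range (point ω), Set.Iic (p.1 0).2 := by
    ext n
    simp [point]
  have h2 : {n : ℕ | ∃ k, n ≤ (ω k).2}.Finite := by
    rw [h1]
    exact (finite_range_point h).biUnion fun _ _ => Set.finite_Iic _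
  exact h2.to_subtype

theorem exists_model {q : ℚ} {κ : ℚ × ℚ} (ha : Admissible q (realVec κ)) (hP : P.IsMachine)
    (h : P.IsComputation ω) : ∃ (M : MarkovChain) (s : M.S), M.Sat s (machineF q κ P) ∧
      M.Covers q (realVec κ) P s ω ∧ (Periodic ω → Finite M.S) := by
  let U := computationUnfolding h
  let t : ℕ → U.T := fun k => ⟨point ω k, k, rfl⟩
  have hs : (U.chain ha).Sat (U.state ha (.lab (t 0))) (machineF q κ P) :=
    U.sat_machineF h.1
  refine ⟨U.chain ha, U.state ha (.lab (t 0)), hs,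
    ⟨MarkovChain.simulates_of_sat_machineF ha hP hs, fun k => U.state ha (.lab (t k)),
      ⟨rfl, fun k => ?_⟩, fun k => U.represents_lab (t k)⟩, fun hp => ?_⟩
  · have hnext : t (k + 1) = U.next (t k) := by
      refine Subtype.ext (Prod.ext (funext fun i => ?_) (Nat.bodd_succ k))
      change ω (k + 1 + i) = ω (k + (i + 1))
      congr 1
      omega
    change (U.chain ha).Succ (U.state ha (.lab (t k))) (U.state ha (.lab (t (k + 1))))
    rw [hnext]
    exact U.succ_next (t k)
  · have h1 : Finite U.T := (finite_range_point hp).to_subtype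
    have h2 : Finite U.N := finite_values hp
    exact inferInstanceAs (Finite (ModelState U.T U.N))

end Computation

/-! ### Computability of the formula -/

theorem code_instrF (q : ℚ) (κ : ℚ × ℚ) (P : Program) (ins : Instr) : (instrF q κ P ins).code =
    Sum.casesOn (Instr.equivSum ins) (fun L => (incInstrF q κ P L).code)
      (fun p => (testDecInstrF q κ P p.1 p.2).code) := by
  cases ins with
  | inc L => rw [instrF]; rfl
  | testDec L L' => rw [instrF]; rfl

/-- The code of the formula `f x` is a primitive recursive function of `x`. -/
def PrimrecCode {α : Type} [Primcodable α] (f : α → Formula) : Prop :=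
  Primrec fun x => (f x).code

namespace PrimrecCode

open Formula

variable {α β : Type} [Primcodable α] [Primcodable β] {f g : α → Formula}

theorem const (φ : Formula) : PrimrecCode fun _ : α => φ := Primrec.const _

theorem neg (hf : PrimrecCode f) : PrimrecCode fun x => .neg (f x) :=
  Primrec₂.natPair.comp (.const 1) hf

theorem conj (hf : PrimrecCode f) (hg : PrimrecCode g) : PrimrecCode fun x => .conj (f x) (g x) :=
  Primrec₂.natPair.comp (.const 2) (Primrec₂.natPair.comp hf hg)

theorem disj (hf : PrimrecCode f) (hg : PrimrecCode g) : PrimrecCode fun x => (f x).disj (g x) :=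
  (hf.neg.conj hg.neg).neg

theorem imp (hf : PrimrecCode f) (hg : PrimrecCode g) : PrimrecCode fun x => (f x).imp (g x) :=
  (hf.conj hg.neg).neg

theorem nextEq (r : ℚ) (hf : PrimrecCode f) : PrimrecCode fun x => nextEq r (f x) :=
  Primrec₂.natPair.comp (.const 3) (Primrec₂.natPair.comp (.const _)
    (Primrec₂.natPair.comp (.const _) hf))

theorem probUntl (c : Cmp) (r : Set.Icc (0 : ℚ) 1) (hf : PrimrecCode f) (hg : PrimrecCode g) :
    PrimrecCode fun x => .probUntl c r (f x) (g x) :=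
  Primrec₂.natPair.comp (.const 4) (Primrec₂.natPair.comp (.const _)
    (Primrec₂.natPair.comp (.const _) (Primrec₂.natPair.comp hf hg)))

theorem probUntlLE (c : Cmp) (r : Set.Icc (0 : ℚ) 1) (k : ℕ) (hf : PrimrecCode f)
    (hg : PrimrecCode g) : PrimrecCode fun x => .probUntlLE c r k (f x) (g x) :=
  Primrec₂.natPair.comp (.const 5) (Primrec₂.natPair.comp (.const _)
    (Primrec₂.natPair.comp (.const _) (Primrec₂.natPair.comp (.const _)
      (Primrec₂.natPair.comp hf hg))))

theorem alwaysAS (hf : PrimrecCode f) : PrimrecCode fun x => (f x).alwaysAS :=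
  probUntl _ _ (const _) hf.neg

theorem untilEq (r : ℚ) (hf : PrimrecCode f) (hg : PrimrecCode g) :
    PrimrecCode fun x => untilEq r (f x) (g x) :=
  probUntlLE _ _ _ hf hg

theorem label {i : α → ℕ} (hi : Primrec i) : PrimrecCode fun x => .atom (.label (i x)) :=
  Primrec₂.natPair.comp (.const 0)
    (Primrec.nat_add.comp (Primrec.nat_mul.comp (.const 2) hi) (.const 2))

theorem ite {p : α → Prop} [DecidablePred p] (hp : PrimrecPred p) (hf : PrimrecCode f)
    (hg : PrimrecCode g) : PrimrecCode fun x => if p x then f x else g x :=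
  (Primrec.ite hp hf hg).of_eq fun x => by dsimp only; split_ifs <;> rfl

theorem bigConj_nil : PrimrecCode fun _ : α => bigConj [] := const _

theorem bigConj_cons {l : α → List Formula} (hf : PrimrecCode f)
    (hl : PrimrecCode fun x => bigConj (l x)) : PrimrecCode fun x => bigConj (f x :: l x) :=
  hf.conj hl

theorem bigConj_map {l : α → List β} (hl : Primrec l) {F : α → β → Formula}
    (hF : PrimrecCode fun p : α × β => F p.1 p.2) :
    PrimrecCode fun x => bigConj ((l x).map (F x)) := by
  have h : Primrec fun x => (l x).foldr
      (fun y c => Nat.pair 2 (Nat.pair (F x y).code c)) Formula.tt.code := by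
    refine Primrec.list_foldr (h := fun x p => Nat.pair 2 (Nat.pair (F x p.1).code p.2))
      hl (.const _) ?_
    exact Primrec₂.natPair.comp (.const 2) (Primrec₂.natPair.comp
      (Primrec.comp (f := fun p : α × β => (F p.1 p.2).code) hF
        (Primrec.pair Primrec.fst (Primrec.fst.comp Primrec.snd)))
      (Primrec.snd.comp Primrec.snd))
  refine h.of_eq fun x => ?_
  change _ = (bigConj ((l x).map (F x))).code
  induction l x with
  | nil => rfl
  | cons y l ih => rw [List.foldr_cons, ih]; rfl

variable {P : α → Program}

theorem noLabel (hP : Primrec P) : PrimrecCode fun x => noLabel (P x) :=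
  bigConj_map (Primrec.list_range.comp (Primrec.list_length.comp hP))
    (F := fun _ i => .neg (.atom (.label (i + 1))))
    (label (Primrec.succ.comp Primrec.snd)).neg

theorem labF (hP : Primrec P) : PrimrecCode fun x => labF (P x) := (noLabel hP).neg

theorem counterF (hP : Primrec P) : PrimrecCode fun x => counterF (P x) :=
  (labF hP).disj (const _)

theorem onlyLabelF (hP : Primrec P) {i : α → ℕ} (hi : Primrec i) :
    PrimrecCode fun x => onlyLabelF (P x) (i x) :=
  (label hi).conj (bigConj_map (Primrec.list_range.comp (Primrec.list_length.comp hP))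
    (F := fun x j => if j + 1 = i x then .tt else .neg (.atom (.label (j + 1))))
    (ite (Primrec.eq.comp (Primrec.succ.comp Primrec.snd) (hi.comp Primrec.fst)) (const _)
      (label (Primrec.succ.comp Primrec.snd)).neg))

theorem targetF (hP : Primrec P) {L : α → Target} (hL : Primrec L) :
    PrimrecCode fun x => targetF (P x) (L x) :=
  (onlyLabelF hP (Primrec.fst.comp hL)).disj (onlyLabelF hP (Primrec.snd.comp hL))

theorem forParityF {F : α → Bool → Formula} (hF : ∀ b, PrimrecCode fun x => F x b) :
    PrimrecCode fun x => forParityF (F x) :=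
  ((const _).imp (hF true)).conj ((const _).imp (hF false))

variable (q : ℚ) (κ : ℚ × ℚ)

theorem throughF (hP : Primrec P) (b : Bool) (hf : PrimrecCode f) :
    PrimrecCode fun x => throughF (P x) b (f x) :=
  ((counterF hP).conj (const _)).disj hf

theorem basicF (hP : Primrec P) : PrimrecCode fun x => basicF q κ (P x) := by
  refine bigConj_cons (const _) <| bigConj_cons (const _) <| bigConj_cons (const _) <|
    bigConj_cons ((counterF hP).imp (const _)) <|
    bigConj_cons ((const _).imp (nextEq _ ((const _).disj (counterF hP)))) <|
    bigConj_cons (const _) <| bigConj_cons (const _) <| bigConj_cons (const _) <|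
    bigConj_cons (const _) <| bigConj_cons ((counterF hP).imp (forParityF fun b => ?_)) bigConj_nil
  exact nextEq _ ((const _).disj ((const _).disj ((counterF hP).conj (const _))))

theorem vectorF (hP : Primrec P) (b : Bool) : PrimrecCode fun x => vectorF q κ (P x) b :=
  bigConj_cons (const _) <| bigConj_cons (const _) <|
    bigConj_cons (probUntlLE _ _ _ (throughF hP b (const _)) (const _)) bigConj_nil

theorem decF (hP : Primrec P) (b : Bool) (hf : PrimrecCode f) :
    PrimrecCode fun x => decF q κ (P x) b (f x) :=
  bigConj_cons (nextEq _ (hf.disj (const _))) <|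
    bigConj_cons (untilEq _ (throughF hP b hf) (const _)) <|
    bigConj_cons (untilEq _ (throughF hP b hf) (const _)) bigConj_nil

theorem incF (hP : Primrec P) (b : Bool) : PrimrecCode fun x => incF q κ (P x) b :=
  bigConj_cons (untilEq _ (throughF hP b (const _))
    (((labF hP).conj (const _)).disj (const _))) <|
  bigConj_cons (untilEq _ (throughF hP b (labF hP)) (const _)) <|
  bigConj_cons (untilEq _ (throughF hP b ((labF hP).disj (const _))) (const _)) bigConj_nil

theorem verifyF (hP : Primrec P) : PrimrecCode fun x => verifyF q κ (P x) :=
  (const _).disj (forParityF fun b => decF q κ hP b (const _))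

theorem incInstrF (hP : Primrec P) {L : α → Target} (hL : Primrec L) :
    PrimrecCode fun x => incInstrF q κ (P x) (L x) :=
  bigConj_cons (forParityF fun b => incF q κ hP b) <| bigConj_cons (verifyF q κ hP) <|
    bigConj_cons (nextEq _ ((targetF hP hL).disj (noLabel hP).alwaysAS)) bigConj_nil

theorem testDecInstrF (hP : Primrec P) {L L' : α → Target} (hL : Primrec L) (hL' : Primrec L') :
    PrimrecCode fun x => testDecInstrF q κ (P x) (L x) (L' x) :=
  disj
    (bigConj_cons (const _) <| bigConj_cons (nextEq _ (labF hP)).neg <|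
      bigConj_cons (nextEq _ (((targetF hP hL).conj (const _)).disj (noLabel hP).alwaysAS))
        bigConj_nil)
    (bigConj_cons (const _) <| bigConj_cons (forParityF fun b => decF q κ hP b (labF hP)) <|
      bigConj_cons (nextEq _ ((targetF hP hL').disj (noLabel hP).alwaysAS)) bigConj_nil)

theorem instrF (hP : Primrec P) {ins : α → Instr} (hi : Primrec ins) :
    PrimrecCode fun x => instrF q κ (P x) (ins x) := by
  have he : Primrec fun x => Instr.equivSum (ins x) := Primrec.of_equiv.comp hi
  have h1 : Primrec₂ fun (x : α) (L : Target) => (PCTL.incInstrF q κ (P x) L).code :=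
    incInstrF q κ (P := fun p : α × Target => P p.1) (hP.comp Primrec.fst) Primrec.snd
  have h2 : Primrec₂ fun (x : α) (p : Target × Target) =>
      (PCTL.testDecInstrF q κ (P x) p.1 p.2).code :=
    testDecInstrF q κ (P := fun p : α × (Target × Target) => P p.1) (hP.comp Primrec.fst)
      (Primrec.fst.comp Primrec.snd) (Primrec.snd.comp Primrec.snd)
  have h := Primrec.sumCasesOn he h1 h2
  exact h.of_eq fun x => (code_instrF q κ (P x) (ins x)).symm

theorem instrAt (hP : Primrec P) {i : α → ℕ} (hi : Primrec i) :
    Primrec fun x => instrAt (P x) (i x) :=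
  (Primrec.list_getD _).comp hP hi

theorem invariantF (hP : Primrec P) : PrimrecCode fun x => invariantF q κ (P x) :=
  bigConj_cons (basicF q κ hP) <|
  bigConj_cons ((counterF hP).imp (forParityF fun b => vectorF q κ hP b)) <|
  bigConj_cons ((const _).imp (verifyF q κ hP)) <|
  bigConj_cons (bigConj_map (Primrec.list_range.comp (Primrec.list_length.comp hP))
    (F := fun x i => (Formula.atom (.label (i + 1))).imp
      (PCTL.instrF q κ (P x) (PCTL.instrAt (P x) i)))
    ((label (Primrec.succ.comp Primrec.snd)).imp (instrF q κ (hP.comp Primrec.fst)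
      (instrAt (hP.comp Primrec.fst) Primrec.snd)))) bigConj_nil

theorem machineF (hP : Primrec P) : PrimrecCode fun x => machineF q κ (P x) :=
  bigConj_cons (onlyLabelF hP (.const _)) <| bigConj_cons (const _) <|
    bigConj_cons (invariantF q κ hP).alwaysAS bigConj_nil

end PrimrecCode

end PCTL
end

theorem mainTheorem3 (q : ℚ) (κ : ℚ × ℚ)
    (hq_gt : 3 / 4 < q) (hq_lt : q < 1)
    (hq_sqrt : ∃ r : ℚ, √(4 * (q : ℝ) - 3) = r)
    (hκ₁ : κ.1 ∈ Set.Ioo (0 : ℚ) 1) (hκ₂ : κ.2 ∈ Set.Ioo (0 : ℚ) 1)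
    (hκ_Iq : (κ.1 : ℝ) ∈ PCTL.Iq q)
    (hκ_sum : κ.1 + κ.2 < q - 1 / 2) :
    ∃ ψ : Minsky.Program → PCTL.Formula,
      -- the formula is effectively constructible from the machine
      Computable (fun P => (ψ P).code) ∧
      ∀ P : Minsky.Program, P.IsMachine →
        -- (A)
        (∀ (M : PCTL.MarkovChain) (s : M.S), M.Sat s (ψ P) →
          M.Simulates q (κ.1, κ.2) P s) ∧
        -- (B)
        (∀ ω : ℕ → Minsky.Config, P.IsComputation ω →
          ∃ (M : PCTL.MarkovChain) (s : M.S), M.Sat s (ψ P) ∧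
            M.Covers q (κ.1, κ.2) P s ω ∧
            (Minsky.Periodic ω → Finite M.S)) := by
  have ha : PCTL.Admissible q (PCTL.realVec κ) :=
    { q_gt := by
        have : ((3 / 4 : ℚ) : ℝ) < q := Rat.cast_lt.2 hq_gt
        simpa using this
      q_lt := by exact_mod_cast hq_lt
      fst_pos := Rat.cast_pos.2 hκ₁.1
      fst_lt := by
        have : (κ.1 : ℝ) < 1 := by exact_mod_cast hκ₁.2
        exact this
      snd_pos := Rat.cast_pos.2 hκ₂.1
      snd_lt := by
        have : (κ.2 : ℝ) < 1 := by exact_mod_cast hκ₂.2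
        exact this
      mem_Iq := hκ_Iq
      sum_lt := by
        have : ((κ.1 + κ.2 : ℚ) : ℝ) < ((q - 1 / 2 : ℚ) : ℝ) := Rat.cast_lt.2 hκ_sum
        push_cast at this
        exact this }
  exact ⟨PCTL.machineF q κ, (PCTL.PrimrecCode.machineF q κ Primrec.id).to_comp, fun P hP =>
    ⟨fun M s hs => PCTL.MarkovChain.simulates_of_sat_machineF ha hP hs,
      fun ω hω => PCTL.exists_model ha hP hω⟩⟩
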